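/- Let $r\ge 1$ and let $F_r$ be the free group with free basis $x_1,\dots,x_r$. Elements of $F_r$ are given as freely reduced words in the $2r$ letters $x_i^{\pm1}$. An element is primitive if it is the image of $x_1$ under some automorphism of $F_r$. The Whitehead graph (without the external edge) of a word $w$ has the $2r$ letters as vertices, and for every pair of consecutive letters $xy$ in $w$ an edge between $x$ and $y^{-1}$; it is complete if any two distinct vertices are joined by an edge. An elementary Whitehead automorphism is given by a letter $a$ and a set $A$ of letters with $a\in A$, $a^{-1}\notin A$: it fixes $a$ and maps every other generator $x\neq a^{\pm1}$ to $a^{-\epsilon}xa^{\delta}$, where $\delta=1$ if $x\in A$ and $\delta=0$ otherwise, and $\epsilon=1$ if $x^{-1}\in A$ and $\epsilon=0$ otherwise. Let $\mathcal A$ be the algorithm that runs the following two procedures in parallel on a cyclically reduced word $u$, and stops as soon as one of them gives an answer. The fast check $\mathcal T$ reads $u$ letter by letter, maintains the Whitehead graph (without the external edge) of the prefix read so far, and answers "not primitive" as soon as this graph is complete; if this never happens, it stops without an answer. The Whitehead algorithm $\mathcal W$ replaces the current cyclically reduced word (initially $u$), as long as possible, by its cyclically reduced image under an elementary Whitehead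 automorphism for which this image is strictly shorter, the automorphisms being tried in some fixed order; it answers "primitive" if the final word has length one, and "not primitive" otherwise. There is a constant $C$ that depends only on $r$ such that the following holds, for every order of the elementary Whitehead automorphisms. 1. Implemented on a (multi-tape) Turing machine, $\mathcal A$ stops on every cyclically reduced word $u$ and decides correctly whether $u$ is primitive; and for every $n\ge 0$, the expected number of steps of $\mathcal A$ on a word chosen uniformly at random among the cyclically reduced words of length $n$ is at most $C$. 2. Implemented on a machine whose memory consists of finitely many double-ended queues, with the first and last letter of every queue accessible in one step, the algorithm that first cyclically reduces its input word (by deleting the first and the last letter as long as they are inverse to each other) and then runs $\mathcal A$ stops on every freely reduced word $u$ and decides correctly whether $u$ is primitive; and for every $n\ge 0$, its expected number of steps on a word chosen uniformly at random among the freely reduced words of length $n$ is at most $C$. -/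

import Mathlib

open scoped ENNReal NNReal

/-! ### Machines with a step count -/

/-- The answer given within `t` steps, if there is one. A step either stops with an answer or leads
to a new configuration; the stopping step is counted. -/
def answerWithin {σ : Type} (step : σ → Bool ⊕ σ) : ℕ → σ → Option Bool
  | 0, _ => none
  | t + 1, c =>
    match step c with
    | Sum.inl b => some b
    | Sum.inr c' => answerWithin step t c'

/-- The number of steps until an answer is given, `⊤` if the computation does not stop. -/
noncomputable def stepCount {σ : Type} (step : σ → Bool ⊕ σ) (c : σ) : ℕ∞ :=
  ⨅ (t : ℕ) (_ : (answerWithin step t c).isSome), (t : ℕ∞)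

/-- A deterministic Turing machine with finitely many two-way infinite tapes, tape alphabet `Γ`
(with blank `default`) and a yes/no answer. In a step it reads the symbols under its heads, and
either stops or changes its state, writes a symbol on every tape and then moves every head by at
most one cell. -/
structure TuringMachine (ι Γ : Type) [Finite ι] [Finite Γ] [Inhabited Γ] where
  State : Type
  finite_state : Finite State
  init : State
  input : ι
  trans : State → (ι → Γ) → Bool ⊕ (State × (ι → Γ × Option Turing.Dir))

namespace TuringMachine

variable {ι Γ : Type} [Finite ι] [Finite Γ] [Inhabited Γ]

/-- A configuration: the state and the tapes. -/
abbrev Cfg (M : TuringMachine ι Γ) : Type := M.State × (ι → Turing.Tape Γ)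

/-- Write a symbol and then move the head, if at all. -/
def applyAct (T : Turing.Tape Γ) (p : Γ × Option Turing.Dir) : Turing.Tape Γ :=
  match p.2 with
  | none => T.write p.1
  | some d => (T.write p.1).move d

def step (M : TuringMachine ι Γ) (c : M.Cfg) : Bool ⊕ M.Cfg :=
  match M.trans c.1 (fun j => (c.2 j).head) with
  | Sum.inl b => Sum.inl b
  | Sum.inr (q, act) => Sum.inr (q, fun j => applyAct (c.2 j) (act j))

/-- The word `u` stands on the input tape, with the head on its first letter; the other tapes are
blank. -/
def start [DecidableEq ι] (M : TuringMachine ι Γ) (u : List Γ) : M.Cfg :=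
  (M.init, fun j => Turing.Tape.mk₁ (if j = M.input then u else []))

/-- On input `u` the machine stops with answer `b`. -/
def Answers [DecidableEq ι] (M : TuringMachine ι Γ) (u : List Γ) (b : Bool) : Prop :=
  ∃ t, answerWithin M.step t (M.start u) = some b

/-- The runtime on input `u`. -/
noncomputable def runtime [DecidableEq ι] (M : TuringMachine ι Γ) (u : List Γ) : ℕ∞ :=
  stepCount M.step (M.start u)

end TuringMachine

/-- The elementary operations on a double-ended queue. -/
inductive DequeOp (Γ : Type) : Type
  | pushFront (c : Γ)
  | pushBack (c : Γ)
  | popFront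
  | popBack

/-- The effect of an operation; popping an empty queue does nothing. -/
def DequeOp.apply {Γ : Type} (l : List Γ) : DequeOp Γ → List Γ
  | pushFront c => c :: l
  | pushBack c => l ++ [c]
  | popFront => l.tail
  | popBack => l.dropLast

/-- A deterministic machine whose memory consists of finitely many double-ended queues. In a step it
sees the first and the last letter of every queue (`none` if the queue is empty), and either stops
or changes its state and performs on every queue a list of elementary operations. There are finitely
many situations, so the number of elementary operations in a step is bounded. -/
structure DequeMachine (ι Γ : Type) [Finite ι] [Finite Γ] where
  State : Type
  finite_state : Finite State
  init : State
  input : ι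
  trans : State → (ι → Option Γ × Option Γ) → Bool ⊕ (State × (ι → List (DequeOp Γ)))

namespace DequeMachine

variable {ι Γ : Type} [Finite ι] [Finite Γ]

/-- A configuration: the state and the queues. -/
abbrev Cfg (M : DequeMachine ι Γ) : Type := M.State × (ι → List Γ)

def step (M : DequeMachine ι Γ) (c : M.Cfg) : Bool ⊕ M.Cfg :=
  match M.trans c.1 (fun j => ((c.2 j).head?, (c.2 j).getLast?)) with
  | Sum.inl b => Sum.inl b
  | Sum.inr (q, act) => Sum.inr (q, fun j => (act j).foldl DequeOp.apply (c.2 j))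

/-- The word `u` stands in the input queue; the other queues are empty. -/
def start [DecidableEq ι] (M : DequeMachine ι Γ) (u : List Γ) : M.Cfg :=
  (M.init, fun j => if j = M.input then u else [])

/-- On input `u` the machine stops with answer `b`. -/
def Answers [DecidableEq ι] (M : DequeMachine ι Γ) (u : List Γ) (b : Bool) : Prop :=
  ∃ t, answerWithin M.step t (M.start u) = some b

/-- The runtime on input `u`. -/
noncomputable def runtime [DecidableEq ι] (M : DequeMachine ι Γ) (u : List Γ) : ℕ∞ :=
  stepCount M.step (M.start u)

end DequeMachine

/-! ### Words, primitive elements, Whitehead automorphisms -/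

/-- The letters `x_i = (i, true)` and `x_i⁻¹ = (i, false)`, as in Mathlib's `FreeGroup`. -/
abbrev Letter (r : ℕ) : Type := Fin r × Bool

/-- The inverse letter. -/
def Letter.inv {r : ℕ} (x : Letter r) : Letter r := (x.1, !x.2)

/-- There is an automorphism of the free group of rank `r` that takes the first generator to `g`. -/
def IsPrimitive {r : ℕ} [NeZero r] (g : FreeGroup (Fin r)) : Prop :=
  ∃ φ : FreeGroup (Fin r) ≃* FreeGroup (Fin r), φ (FreeGroup.of 0) = g

open Classical in
/-- The freely reduced words of length `n`, that is, the elements of length `n` of the free group. -/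
noncomputable def reducedWords (r n : ℕ) : Finset (Fin n → Letter r) :=
  {w | FreeGroup.IsReduced (List.ofFn w)}

open Classical in
/-- The cyclically reduced words of length `n`. -/
noncomputable def cyclicallyReducedWords (r n : ℕ) : Finset (Fin n → Letter r) :=
  {w | FreeGroup.IsCyclicallyReduced (List.ofFn w)}

/-- The expected value of `X` on a uniformly random word of the finite set `S`. -/
noncomputable def expectation {r n : ℕ} (S : Finset (Fin n → Letter r))
    (X : List (Letter r) → ℕ∞) : ℝ≥0∞ :=
  (∑ w ∈ S, (X (List.ofFn w) : ℝ≥0∞)) / (S.card : ℝ≥0∞)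

/-- The data `(a, A)` of an elementary Whitehead automorphism: a letter `a` and a set `A` of letters
that contains `a` but not `a⁻¹`. -/
abbrev WhiteheadDatum (r : ℕ) : Type :=
  {p : Letter r × Finset (Letter r) // p.1 ∈ p.2 ∧ p.1.inv ∉ p.2}

namespace WhiteheadDatum

variable {r : ℕ}

/-- `a` if `x ∈ A`, and the empty word otherwise. -/
def tail (φ : WhiteheadDatum r) (x : Letter r) : FreeGroup (Fin r) :=
  if x ∈ φ.1.2 then FreeGroup.mk [φ.1.1] else 1

/-- The elementary Whitehead automorphism with data `(a, A)`: it fixes `a`, and takes every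
generator `x ≠ a, a⁻¹` to `x`, `x a`, `a⁻¹ x` or `a⁻¹ x a`, where the factor `a` is present if
`x ∈ A`, and the factor `a⁻¹` is present if `x⁻¹ ∈ A`. -/
def hom (φ : WhiteheadDatum r) : FreeGroup (Fin r) →* FreeGroup (Fin r) :=
  FreeGroup.lift fun i =>
    if i = φ.1.1.1 then FreeGroup.of i
    else (φ.tail (i, false))⁻¹ * FreeGroup.of i * φ.tail (i, true)

/-- The letter `x` itself, except that `a` and `a⁻¹` are deleted. -/
def keep (φ : WhiteheadDatum r) (x : Letter r) : Option (Letter r) :=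
  if x.1 = φ.1.1.1 then none else some x

/-- What is to be inserted between the consecutive letters `x` and `y`: the result of cancellation
in `a ^ [x ∈ A] * a ^ (-[y⁻¹ ∈ A])`. -/
def glue (φ : WhiteheadDatum r) (x y : Letter r) : Option (Letter r) :=
  if x ∈ φ.1.2 then (if y.inv ∈ φ.1.2 then none else some φ.1.1)
  else (if y.inv ∈ φ.1.2 then some φ.1.1.inv else none)

/-- The image of the nonempty word `x :: w`, read up to the letter `f` that follows it. -/
def image (φ : WhiteheadDatum r) (f : Letter r) : Letter r → List (Letter r) → List (Letter r)
  | x, [] => (φ.keep x).toList ++ (φ.glue x f).toList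
  | x, y :: w => (φ.keep x).toList ++ (φ.glue x y).toList ++ φ.image f y w

theorem mk_inv (x : Letter r) :
    (FreeGroup.mk [x.inv] : FreeGroup (Fin r)) = (FreeGroup.mk [x])⁻¹ := by
  simp [FreeGroup.inv_mk, FreeGroup.invRev, Letter.inv]

theorem mk_glue (φ : WhiteheadDatum r) (x y : Letter r) :
    (FreeGroup.mk (φ.glue x y).toList : FreeGroup (Fin r)) = φ.tail x * (φ.tail y.inv)⁻¹ := by
  unfold glue tail
  split_ifs
  · rw [mul_inv_cancel]; rfl
  · simp
  · simp [mk_inv]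
  · simp [← FreeGroup.one_eq_mk]

theorem hom_letter (φ : WhiteheadDatum r) (x : Letter r) :
    φ.hom (FreeGroup.mk [x]) =
      (φ.tail x.inv)⁻¹ * FreeGroup.mk (φ.keep x).toList * φ.tail x := by
  obtain ⟨⟨⟨k, c⟩, A⟩, ha, ha'⟩ := φ
  obtain ⟨i, d⟩ := x
  simp only [Letter.inv] at ha ha'
  have hm : (FreeGroup.mk [(i, false)] : FreeGroup (Fin r)) = (FreeGroup.of i)⁻¹ :=
    mk_inv (i, true)
  have ht : (FreeGroup.mk [(i, true)] : FreeGroup (Fin r)) = FreeGroup.of i := rfl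
  by_cases h : i = k
  · subst h
    cases c <;> cases d <;> simp only [Bool.not_true, Bool.not_false] at ha' <;>
      simp [hom, tail, keep, Letter.inv, hm, ht, ha, ha', ← FreeGroup.one_eq_mk]
  · cases d
    · simp only [hom, tail, keep, Letter.inv, hm, map_inv, FreeGroup.lift_apply_of, h, if_false,
        Option.toList, Bool.not_false]
      group
    · simp only [hom, tail, keep, Letter.inv, ht, FreeGroup.lift_apply_of, h, if_false,
        Option.toList, Bool.not_true]

/-- Letting `f = x`, the word `image` represents a conjugate of the image of `x :: w` under the
Whitehead automorphism; that is, it represents the image of the cyclic word `x :: w`. -/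
theorem mk_image (φ : WhiteheadDatum r) (f x : Letter r) (w : List (Letter r)) :
    (FreeGroup.mk (φ.image f x w) : FreeGroup (Fin r)) =
      φ.tail x.inv * φ.hom (FreeGroup.mk (x :: w)) * (φ.tail f.inv)⁻¹ := by
  induction w generalizing x with
  | nil =>
    rw [image, ← FreeGroup.mul_mk, mk_glue, hom_letter]
    group
  | cons y w ih =>
    have h : (FreeGroup.mk (x :: y :: w) : FreeGroup (Fin r)) =
        FreeGroup.mk [x] * FreeGroup.mk (y :: w) := by
      rw [FreeGroup.mul_mk]; rfl
    rw [image, ← FreeGroup.mul_mk, ← FreeGroup.mul_mk, mk_glue, ih, h, map_mul, hom_letter]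
    group

end WhiteheadDatum

/-! ### The algorithm -/

/-- The number of elementary Whitehead automorphisms. -/
abbrev numWhitehead (r : ℕ) : ℕ := Fintype.card (WhiteheadDatum r)

/-- The edges added to a Whitehead graph (without the external edge) when the letter `y` is read
after the letter `p` (if any): an edge from `p` to `y⁻¹`. -/
def addEdge {r : ℕ} (E : Finset (Sym2 (Letter r))) : Option (Letter r) → Letter r →
    Finset (Sym2 (Letter r))
  | none, _ => E
  | some x, y => insert s(x, y.inv) E

/-- Any two vertices are connected by an edge. -/
abbrev IsCompleteGraph {r : ℕ} (E : Finset (Sym2 (Letter r))) : Prop :=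
  ∀ x y : Letter r, x ≠ y → s(x, y) ∈ E

/-- The states of the algorithm. Tape `0` is the input tape; one of the tapes `1` and `2` contains
the current word of the Whitehead algorithm, the other one the image of the current word under the
Whitehead automorphism that is being tried. The entry `b` tells which is which, and `i` is the
index of the automorphism. -/
inductive AState (r : ℕ) : Type
  /-- the fast check has found the edges `E` and has read `p` last; the Whitehead algorithm copies
  the input to its work tape -/
  | read (E : Finset (Sym2 (Letter r))) (p : Option (Letter r))
  /-- the head of the current word goes back to its beginning -/
  | rewind (b : Bool) (i : Fin (numWhitehead r + 1))
  /-- the head of the current word is at its beginning -/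
  | begins (b : Bool) (i : Fin (numWhitehead r + 1))
  /-- the image of the letter `x` is to be written; the current word begins with `f` -/
  | keep (b : Bool) (i : Fin (numWhitehead r)) (f x : Letter r)
  /-- the letter between the images of `x` and of the letter after it is to be written -/
  | glue (b : Bool) (i : Fin (numWhitehead r)) (f x : Letter r)
  /-- the image is complete, both heads are behind their words -/
  | turn (b : Bool) (i : Fin (numWhitehead r))
  /-- compare the lengths of the current word and of its image -/
  | compare (b : Bool) (i : Fin (numWhitehead r))
  /-- the head of the work tape that is not needed any more goes to the end of its word -/
  | seek (b : Bool) (i : Fin (numWhitehead r + 1))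
  /-- that word is erased -/
  | wipe (b : Bool) (i : Fin (numWhitehead r + 1))
  /-- no automorphism makes the current word shorter: is there a second letter? -/
  | final (b : Bool)
  deriving Fintype

/-- The tape with the current word. -/
def curTape (b : Bool) : Fin 3 := if b then 2 else 1

/-- The tape with the image of the current word. -/
def imgTape (b : Bool) : Fin 3 := if b then 1 else 2

/-- Change the action `act` on tape `j`: write `c` and move as `d` says. -/
def onTape {r : ℕ} (act : Fin 3 → Option (Letter r) × Option Turing.Dir) (j : Fin 3)
    (c : Option (Letter r)) (d : Option Turing.Dir) : Fin 3 → Option (Letter r) × Option Turing.Dir :=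
  Function.update act j (c, d)

/-- Append the letter, if there is one, to the word on tape `j`, whose head is behind the word. -/
def appendTo {r : ℕ} (act : Fin 3 → Option (Letter r) × Option Turing.Dir) (j : Fin 3) :
    Option (Letter r) → Fin 3 → Option (Letter r) × Option Turing.Dir
  | none => act
  | some c => onTape act j (some c) (some .right)

/-- The transition function of the algorithm, given an enumeration `e` of the Whitehead
automorphisms. -/
def aTrans {r : ℕ} (e : Fin (numWhitehead r) ≃ WhiteheadDatum r) (q : AState r)
    (s : Fin 3 → Option (Letter r)) :
    Bool ⊕ (AState r × (Fin 3 → Option (Letter r) × Option Turing.Dir)) :=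
  let idle : Fin 3 → Option (Letter r) × Option Turing.Dir := fun j => (s j, none)
  let move (act : Fin 3 → Option (Letter r) × Option Turing.Dir) (j : Fin 3) (d : Turing.Dir) :=
    onTape act j (s j) (some d)
  match q with
  | .read E p =>
    match s 0 with
    | none => .inr (.rewind false 0, move idle (curTape false) .left)
    | some y =>
      if IsCompleteGraph (addEdge E p y) then .inl false
      else .inr (.read (addEdge E p y) (some y),
        appendTo (move idle 0 .right) (curTape false) (some y))
  | .rewind b i =>
    match s (curTape b) with
    | some _ => .inr (.rewind b i, move idle (curTape b) .left)
    | none => .inr (.begins b i, move idle (curTape b) .right)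
  | .begins b i =>
    match s (curTape b) with
    | none => .inl false
    | some y =>
      if h : i.1 < numWhitehead r then .inr (.keep b ⟨i.1, h⟩ y y, move idle (curTape b) .right)
      else .inr (.final b, move idle (curTape b) .right)
  | .keep b i f x => .inr (.glue b i f x, appendTo idle (imgTape b) ((e i).keep x))
  | .glue b i f x =>
    match s (curTape b) with
    | some y => .inr (.keep b i f y,
        appendTo (move idle (curTape b) .right) (imgTape b) ((e i).glue x y))
    | none => .inr (.turn b i, appendTo idle (imgTape b) ((e i).glue x f))
  | .turn b i => .inr (.compare b i, move (move idle (curTape b) .left) (imgTape b) .left)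
  | .compare b i =>
    match s (curTape b), s (imgTape b) with
    | some _, some _ => .inr (.compare b i, move (move idle (curTape b) .left) (imgTape b) .left)
    -- the image is shorter: it becomes the current word, and the old one is erased
    | some _, none => .inr (.seek (!b) 0, move idle (curTape b) .right)
    -- the image is not shorter: it is erased, and the next automorphism is tried
    | none, _ => .inr (.seek b i.succ, move idle (imgTape b) .right)
  | .seek b i =>
    match s (imgTape b) with
    | some _ => .inr (.seek b i, move idle (imgTape b) .right)
    | none => .inr (.wipe b i, move idle (imgTape b) .left)
  | .wipe b i =>
    match s (imgTape b) with
    | some _ => .inr (.wipe b i, onTape idle (imgTape b) none (some .left))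
    | none => .inr (.rewind b i, idle)
  | .final b =>
    match s (curTape b) with
    | none => .inl true
    | some _ => .inl false

/-- The fast check in parallel with the Whitehead algorithm, on a Turing machine. While the input is
read for the first time, the fast check builds the Whitehead graph of the prefix read so far and
stops with the answer "not primitive" as soon as this graph is complete; at the same time the
Whitehead algorithm copies the input. When the input is exhausted, the Whitehead algorithm goes on:
as long as there is an elementary Whitehead automorphism that makes the current cyclic word shorter,
it applies the first one; the answer is "primitive" if the final word has length one. -/
def algorithmA {r : ℕ} (e : Fin (numWhitehead r) ≃ WhiteheadDatum r) :
    TuringMachine (Fin 3) (Option (Letter r)) where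
  State := AState r
  finite_state := inferInstance
  init := .read ∅ none
  input := 0
  trans := aTrans e

/-- The operations that perform a Turing machine action on a tape kept in two queues: the queue
`true` contains the symbol under the head and the symbols to the right of it, the queue `false` those
to the left of the head, the nearest one first. Here `l` is the symbol to the left of the head. -/
def tapeOps {Γ : Type} (l : Γ) : Γ × Option Turing.Dir → Bool → List (DequeOp Γ)
  | (c, none), true => [.popFront, .pushFront c]
  | (_, none), false => []
  | (_, some .right), true => [.popFront]
  | (c, some .right), false => [.pushFront c]
  | (c, some .left), true => [.popFront, .pushFront c, .pushFront l]
  | (_, some .left), false => [.popFront]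

/-- Are these the first and the last letter of a word that is not cyclically reduced? -/
def cancels {r : ℕ} : Option (Option (Letter r)) × Option (Option (Letter r)) → Bool
  | (some (some a), some (some z)) => z = a.inv
  | _ => false

/-- The algorithm on a machine with double-ended queues: as long as the last letter of the word in
the input queue is the inverse of the first one, both are deleted; then the algorithm above is
carried out step by step, every tape being kept in two queues. -/
def dequeAlgorithm {r : ℕ} (e : Fin (numWhitehead r) ≃ WhiteheadDatum r) :
    DequeMachine (Fin 3 × Bool) (Option (Letter r)) where
  State := Option (AState r)
  finite_state := inferInstance
  init := none
  input := (0, true)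
  trans
    | none, s =>
      if cancels (s (0, true)) then
        .inr (none, fun j => if j = (0, true) then [.popFront, .popBack] else [])
      else .inr (some (.read ∅ none), fun _ => [])
    | some q, s =>
      match aTrans e q (fun j => ((s (j, true)).1).getD none) with
      | .inl b => .inl b
      | .inr (q', act) =>
        .inr (some q', fun j => tapeOps (((s (j.1, false)).1).getD none) (act j.1) j.2)

/-!
Words for a basis of the free group label loops in a wedge of circles, and Stallings folds turn this
graph into the rose with `r` petals. If one of the words is longer than a letter, consider the graph
before the last fold. It has two vertices, and one of the folded edges joins them; contracting that
edge, instead of folding it, is the effect of an elementary Whitehead automorphism `(a, A)`, and it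
makes every loop through the edge shorter. Hence a primitive word of length at least two can be
shortened (if its loop avoids the edge, the other elements of the basis are shortened first), so
that the Whitehead algorithm is correct. Moreover, every edge of the Whitehead graph of the word is
a passage of its loop through a vertex, so that no edge joins `a⁻¹` to a letter of `A` other than
`a`, and the graph is not complete.

Whatever has been read of a random reduced word, the next `L` letters make the graph complete with
probability at least some positive constant, so that the probability that the graph of a prefix of
length `n` is not complete decays exponentially. This outweighs the quadratic time that the
Whitehead algorithm needs. A positive fraction of the reduced words is cyclically reduced. Finally,
a word of length `n` is left by a cancellation at the ends of at most `2 * r` of the reduced words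
of length `n + 2`, while there are at least `4 * r` times as many of these as reduced words of
length `n`, so that the expected number of cancellations is bounded.
-/

/-! ### Labelled graphs and Stallings folds -/

@[simp]
theorem Letter.inv_inv {r : ℕ} (x : Letter r) : x.inv.inv = x := by
  simp [Letter.inv]

@[simp]
theorem Letter.inv_ne {r : ℕ} (x : Letter r) : x.inv ≠ x := by
  simp [Letter.inv, Prod.ext_iff]

theorem Letter.eq_or_eq_inv {r : ℕ} {x y : Letter r} (h : x.1 = y.1) : x = y ∨ x = y.inv := by
  obtain ⟨i, b⟩ := x
  obtain ⟨j, c⟩ := y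
  cases b <;> cases c <;> simp_all [Letter.inv]

theorem invRev_cons {r : ℕ} (x : Letter r) (l : List (Letter r)) :
    FreeGroup.invRev (x :: l) = FreeGroup.invRev l ++ [x.inv] := by
  simp [FreeGroup.invRev, Letter.inv]

theorem mk_cons {r : ℕ} (x : Letter r) (l : List (Letter r)) :
    (FreeGroup.mk (x :: l) : FreeGroup (Fin r)) = FreeGroup.mk [x] * FreeGroup.mk l := by
  rw [FreeGroup.mul_mk, List.singleton_append]

theorem injOn_erase_of_card_le_succ {α β : Type*} [DecidableEq α] {s : Finset α} {t : Finset β}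
    {f : α → β} (hmaps : Set.MapsTo f s t) (hsurj : Set.SurjOn f s t)
    (hcard : s.card ≤ t.card + 1) {x y : α} (hx : x ∈ s) (hy : y ∈ s) (hxy : x ≠ y)
    (hf : f x = f y) : Set.InjOn f (s.erase y) := by
  have hsurj' : Set.SurjOn f (s.erase y) t := by
    intro b hb
    obtain ⟨z, hz, rfl⟩ := hsurj hb
    obtain rfl | hzy := eq_or_ne z y
    · exact ⟨x, Finset.mem_coe.2 (Finset.mem_erase.2 ⟨hxy, hx⟩), hf⟩
    · exact ⟨z, Finset.mem_coe.2 (Finset.mem_erase.2 ⟨hzy, hz⟩), rfl⟩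
  refine Finset.injOn_of_surjOn_of_card_le f (fun z hz => hmaps (Finset.mem_of_mem_erase hz))
    hsurj' ?_
  rw [Finset.card_erase_of_mem hy]
  omega

namespace Folding

variable {r : ℕ} {V W : Type*}

/-- The edge from `u` to `v` with label `x` of a graph with labelled oriented edges. An edge
labelled `x⁻¹` is an edge labelled `x` in the other direction; the orientation with a generator as
label is recorded. -/
def posEdge (u : V) (x : Letter r) (v : V) : V × Fin r × V :=
  if x.2 then (u, x.1, v) else (v, x.1, u)

theorem posEdge_inv (u : V) (x : Letter r) (v : V) : posEdge v x.inv u = posEdge u x v := by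
  rcases x with ⟨i, _ | _⟩ <;> rfl

theorem posEdge_label (u : V) (x : Letter r) (v : V) : (posEdge u x v).2.1 = x.1 := by
  rcases x with ⟨i, _ | _⟩ <;> rfl

theorem posEdge_inj {u u' v v' : V} {x : Letter r} :
    posEdge u x v = posEdge u' x v' ↔ u = u' ∧ v = v' := by
  rcases x with ⟨i, _ | _⟩ <;> simp [posEdge, and_comm]

theorem posEdge_map (f : V → W) (u : V) (x : Letter r) (v : V) :
    Prod.map f (Prod.map id f) (posEdge u x v) = posEdge (f u) x (f v) := by
  rcases x with ⟨i, _ | _⟩ <;> rfl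

/-- The word `l` can be read along a path from `u` to `v` in the graph with edges `E`. -/
def Reads (E : Finset (V × Fin r × V)) : V → List (Letter r) → V → Prop
  | u, [], v => u = v
  | u, x :: l, v => ∃ m, posEdge u x m ∈ E ∧ Reads E m l v

theorem reads_append {E : Finset (V × Fin r × V)} {u z : V} {l l' : List (Letter r)} :
    Reads E u (l ++ l') z ↔ ∃ v, Reads E u l v ∧ Reads E v l' z := by
  induction l generalizing u with
  | nil => simp [Reads]
  | cons x l ih =>
    simp only [List.cons_append, Reads, ih]
    grind

theorem Reads.append {E : Finset (V × Fin r × V)} {u v z : V} {l l' : List (Letter r)}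
    (h : Reads E u l v) (h' : Reads E v l' z) : Reads E u (l ++ l') z :=
  reads_append.2 ⟨v, h, h'⟩

theorem Reads.invRev {E : Finset (V × Fin r × V)} {u v : V} {l : List (Letter r)}
    (h : Reads E u l v) : Reads E v (FreeGroup.invRev l) u := by
  induction l generalizing u with
  | nil => cases h; rfl
  | cons x l ih =>
    obtain ⟨m, hm, h⟩ := h
    rw [invRev_cons]
    exact (ih h).append ⟨u, by rwa [posEdge_inv], rfl⟩

theorem Reads.red {E : Finset (V × Fin r × V)}
    (hE : ∀ u x v v', posEdge u x v ∈ E → posEdge u x v' ∈ E → v = v')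
    {u v : V} {l l' : List (Letter r)} (hr : FreeGroup.Red l l') (h : Reads E u l v) :
    Reads E u l' v := by
  induction hr with
  | refl => exact h
  | tail _ hs ih =>
    obtain @⟨l₁, l₂, x, b⟩ := hs
    obtain ⟨p, h₁, q, hq, p', hp', h₂⟩ := reads_append.1 ih
    obtain rfl : p' = p := hE q (x, !b) p' p hp' (posEdge_inv p (x, b) q ▸ hq)
    exact h₁.append h₂

section Loops

variable {ι : Type*}

/-- The paths with labels `w i` whose vertices are described by `T` are loops at `v₀`, and every
vertex is met by one of them. -/
structure IsLoops (w : ι → List (Letter r)) (T : ι → ℕ → V) (v₀ : V) : Prop where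
  start : ∀ i, T i 0 = v₀
  finish : ∀ i, T i (w i).length = v₀
  surj : ∀ v, ∃ i k, k ≤ (w i).length ∧ T i k = v

variable {w : ι → List (Letter r)} {T : ι → ℕ → V} {v₀ : V}

theorem IsLoops.comp (h : IsLoops w T v₀) {f : V → W} (hf : Function.Surjective f) :
    IsLoops w (fun i k => f (T i k)) (f v₀) where
  start i := by rw [h.start]
  finish i := by rw [h.finish]
  surj v := by
    obtain ⟨u, rfl⟩ := hf v
    obtain ⟨i, k, hk, rfl⟩ := h.surj u
    exact ⟨i, k, hk, rfl⟩

variable [Fintype ι] [DecidableEq V] [DecidableEq W]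

/-- The edges traversed by paths with the labels `w i`, where `T i k` is the vertex at time `k` of
the path with label `w i`. -/
def traceEdges (w : ι → List (Letter r)) (T : ι → ℕ → V) : Finset (V × Fin r × V) :=
  Finset.univ.image fun p : (i : ι) × Fin (w i).length =>
    posEdge (T p.1 p.2) (w p.1)[p.2] (T p.1 (p.2 + 1))

theorem posEdge_mem_traceEdges (i : ι) {k : ℕ} (hk : k < (w i).length) :
    posEdge (T i k) (w i)[k] (T i (k + 1)) ∈ traceEdges w T :=
  Finset.mem_image.2 ⟨⟨i, ⟨k, hk⟩⟩, Finset.mem_univ _, rfl⟩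

theorem mem_traceEdges {e : V × Fin r × V} :
    e ∈ traceEdges w T ↔
      ∃ i k, ∃ hk : k < (w i).length, posEdge (T i k) (w i)[k] (T i (k + 1)) = e := by
  simp [traceEdges, Sigma.exists, Fin.exists_iff]

theorem traceEdges_comp (f : V → W) :
    traceEdges w (fun i k => f (T i k)) =
      (traceEdges w T).image (Prod.map f (Prod.map id f)) := by
  rw [traceEdges, traceEdges, Finset.image_image]
  congr 1
  funext p
  exact (posEdge_map f _ _ _).symm

theorem IsLoops.reads_take (h : IsLoops w T v₀) (i : ι) {k : ℕ} (hk : k ≤ (w i).length) :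
    Reads (traceEdges w T) v₀ ((w i).take k) (T i k) := by
  induction k with
  | zero => exact (h.start i).symm
  | succ k ih =>
    rw [List.take_succ_eq_append_getElem (by omega)]
    exact (ih (by omega)).append ⟨_, posEdge_mem_traceEdges i (by omega), rfl⟩

theorem IsLoops.exists_reads_to (h : IsLoops w T v₀) (v : V) :
    ∃ l, Reads (traceEdges w T) v₀ l v := by
  obtain ⟨i, k, hk, rfl⟩ := h.surj v
  exact ⟨_, h.reads_take i hk⟩

theorem IsLoops.exists_reads_mk_eq (h : IsLoops w T v₀)
    (hw : Subgroup.closure (Set.range fun i => FreeGroup.mk (w i)) = ⊤) (g : FreeGroup (Fin r)) :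
    ∃ l, Reads (traceEdges w T) v₀ l v₀ ∧ FreeGroup.mk l = g := by
  have hg : g ∈ Subgroup.closure (Set.range fun i => FreeGroup.mk (w i)) := hw ▸ Subgroup.mem_top g
  induction hg using Subgroup.closure_induction with
  | mem x hx =>
    obtain ⟨i, rfl⟩ := hx
    have := h.reads_take i le_rfl
    rw [List.take_length, h.finish] at this
    exact ⟨w i, this, rfl⟩
  | one => exact ⟨[], rfl, rfl⟩
  | mul x y _ _ hx hy =>
    obtain ⟨l, hl, rfl⟩ := hx
    obtain ⟨l', hl', rfl⟩ := hy
    exact ⟨l ++ l', hl.append hl', by rw [FreeGroup.mul_mk]⟩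
  | inv x _ hx =>
    obtain ⟨l, hl, rfl⟩ := hx
    exact ⟨_, hl.invRev, by rw [FreeGroup.inv_mk]⟩

/-- Without folds, the fundamental group of the graph embeds into the free group; if it is also
mapped onto the free group, then every letter is the label of a loop at `v₀`. -/
theorem IsLoops.exists_fold [Nontrivial V] (h : IsLoops w T v₀)
    (hw : Subgroup.closure (Set.range fun i => FreeGroup.mk (w i)) = ⊤) :
    ∃ u x v v', posEdge u x v ∈ traceEdges w T ∧ posEdge u x v' ∈ traceEdges w T ∧ v ≠ v' := by
  by_contra! hE
  have hloop (x : Letter r) : posEdge v₀ x v₀ ∈ traceEdges w T := by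
    obtain ⟨l, hl, hx⟩ := h.exists_reads_mk_eq hw (FreeGroup.mk [x])
    have hred : FreeGroup.Red l [x] := by
      rw [← FreeGroup.reduce_singleton x, ← FreeGroup.reduce.sound hx]
      exact FreeGroup.reduce.red
    obtain ⟨m, hm, rfl⟩ := hl.red hE hred
    exact hm
  have hstay : ∀ l v, Reads (traceEdges w T) v₀ l v → v₀ = v := by
    intro l
    induction l with
    | nil => exact fun v h => h
    | cons x l ih =>
      rintro v ⟨m, hm, hl⟩
      obtain rfl : m = v₀ := hE _ _ _ _ hm (hloop x)
      exact ih v hl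
  obtain ⟨v, hv⟩ := exists_ne v₀
  obtain ⟨l, hl⟩ := h.exists_reads_to v
  exact hv (hstay l v hl).symm

/-- Otherwise the exponent sum of the generator `j` would vanish on the whole free group. -/
theorem IsLoops.exists_mem_traceEdges_label_eq (h : IsLoops w T v₀)
    (hw : Subgroup.closure (Set.range fun i => FreeGroup.mk (w i)) = ⊤) (j : Fin r) :
    ∃ e ∈ traceEdges w T, e.2.1 = j := by
  by_contra! hj
  let ψ : FreeGroup (Fin r) →* Multiplicative ℤ :=
    FreeGroup.lift fun i => if i = j then Multiplicative.ofAdd 1 else 1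
  have hψ : ∀ l u v, Reads (traceEdges w T) u l v → ψ (FreeGroup.mk l) = 1 := by
    intro l
    induction l with
    | nil => intro u v _; rw [← FreeGroup.one_eq_mk, map_one]
    | cons x l ih =>
      rintro u v ⟨m, hm, hl⟩
      have hx : x.1 ≠ j := posEdge_label u x m ▸ hj _ hm
      rw [mk_cons, map_mul, ih _ _ hl, mul_one, FreeGroup.lift_mk]
      simp [hx]
  obtain ⟨l, hl, hlj⟩ := h.exists_reads_mk_eq hw (FreeGroup.of j)
  have hone : ψ (FreeGroup.of j) = 1 := hlj ▸ hψ l _ _ hl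
  simp [ψ] at hone

end Loops

section LoopGraph

variable {ι : Type} [Fintype ι] {w : ι → List (Letter r)}

/-- There are loops with labels `w i` in a connected graph with `m` vertices, whose fundamental
group has at most the rank of a free group on `ι`. -/
def HasLoopGraph (w : ι → List (Letter r)) (m : ℕ) : Prop :=
  ∃ (V : Type) (_ : Fintype V) (_ : DecidableEq V) (T : ι → ℕ → V) (v₀ : V),
    IsLoops w T v₀ ∧ Fintype.card V = m ∧ (traceEdges w T).card + 1 ≤ m + Fintype.card ι

/-- The graph is a wedge of circles. -/
theorem hasLoopGraph_of_ne_nil [Nonempty ι] (hne : ∀ i, w i ≠ []) :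
    HasLoopGraph w (1 + ∑ i, ((w i).length - 1)) := by
  classical
  let V := Option ((i : ι) × Fin ((w i).length - 1))
  let T : ι → ℕ → V := fun i k =>
    if h : 0 < k ∧ k < (w i).length then some ⟨i, ⟨k - 1, by omega⟩⟩ else none
  have hloops : IsLoops w T none := by
    refine ⟨fun i => by simp [T], fun i => by simp [T], ?_⟩
    rintro (_ | ⟨i, k, hk⟩)
    · exact ⟨Classical.arbitrary ι, 0, by omega, by simp [T]⟩
    · have : k + 1 < (w i).length := by omega
      exact ⟨i, k + 1, this.le, by simp [T, this]⟩
  refine ⟨V, inferInstance, inferInstance, T, none, hloops, by simp [V, add_comm], ?_⟩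
  have hcard : (traceEdges w T).card ≤ ∑ i, (w i).length :=
    Finset.card_image_le.trans (by simp)
  have hsum : ∑ i, (w i).length = ∑ i, ((w i).length - 1) + Fintype.card ι := by
    have hpred (i : ι) : (w i).length = ((w i).length - 1) + 1 := by
      have := List.length_pos_iff.2 (hne i)
      omega
    simp [Finset.sum_congr rfl fun i _ => hpred i, Finset.sum_add_distrib]
  omega

theorem HasLoopGraph.of_succ {m : ℕ} (hm : 2 ≤ m) (h : HasLoopGraph w (m + 1))
    (hw : Subgroup.closure (Set.range fun i => FreeGroup.mk (w i)) = ⊤) :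
    HasLoopGraph w m := by
  obtain ⟨V, _, _, T, v₀, hT, hV, hcard⟩ := h
  have : Nontrivial V := Fintype.one_lt_card_iff_nontrivial.1 (by omega)
  obtain ⟨u, x, v, v', he, he', hne⟩ := hT.exists_fold hw
  let f : V → {z : V // z ≠ v'} := fun z => if h : z = v' then ⟨v, hne⟩ else ⟨z, h⟩
  have hf : Function.Surjective f := fun ⟨z, hz⟩ => ⟨z, by simp [f, hz]⟩
  have hfv : f v = f v' := by simp [f, hne]
  have hlt : (traceEdges w fun i k => f (T i k)).card < (traceEdges w T).card := by
    rw [traceEdges_comp]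
    refine lt_of_le_of_ne Finset.card_image_le fun heq => ?_
    have hinj := Finset.card_image_iff.1 heq he he' (by rw [posEdge_map, posEdge_map, hfv])
    exact hne (posEdge_inj.1 hinj).2
  exact ⟨{z : V // z ≠ v'}, inferInstance, inferInstance, _, _, hT.comp hf, by simp [hV], by omega⟩

theorem hasLoopGraph_two [Nonempty ι] (hne : ∀ i, w i ≠ []) (hlong : ∃ i, 2 ≤ (w i).length)
    (hw : Subgroup.closure (Set.range fun i => FreeGroup.mk (w i)) = ⊤) :
    HasLoopGraph w 2 := by
  have hdescend (m : ℕ) (hm : 2 ≤ m) : HasLoopGraph w m → HasLoopGraph w 2 := by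
    induction m, hm using Nat.le_induction with
    | base => exact id
    | succ m hm ih => exact fun h => ih (h.of_succ hm hw)
  refine hdescend _ ?_ (hasLoopGraph_of_ne_nil hne)
  obtain ⟨i, hi⟩ := hlong
  have := Finset.single_le_sum (f := fun i => (w i).length - 1) (fun _ _ => Nat.zero_le _)
    (Finset.mem_univ i)
  omega

/-- The graph before the last fold, with its vertices named such that the fold involves an edge from
`false` to `false` and an edge from `false` to `true`. -/
theorem exists_isLoops_bool [Nonempty ι] (hne : ∀ i, w i ≠ []) (hlong : ∃ i, 2 ≤ (w i).length)
    (hw : Subgroup.closure (Set.range fun i => FreeGroup.mk (w i)) = ⊤) :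
    ∃ (T : ι → ℕ → Bool) (v₀ : Bool) (a : Letter r), IsLoops w T v₀ ∧
      (traceEdges w T).card ≤ Fintype.card ι + 1 ∧
      posEdge false a false ∈ traceEdges w T ∧ posEdge false a true ∈ traceEdges w T := by
  obtain ⟨V, _, _, T, v₀, hT, hV, hcard⟩ := hasLoopGraph_two hne hlong hw
  have : Nontrivial V := Fintype.one_lt_card_iff_nontrivial.1 (by omega)
  obtain ⟨u, a, v, v', he, he', hvv'⟩ := hT.exists_fold hw
  let g : V ≃ Bool := Fintype.equivOfCardEq (by simp [hV])
  let f : V → Bool := fun z => xor (g u) (g z)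
  have hf : Function.Bijective f := by
    refine ⟨fun x y hxy => g.injective (by simpa [f] using hxy), fun b => ?_⟩
    exact ⟨g.symm (xor (g u) b), by simp [f]⟩
  have hedge {z : V} (h : posEdge u a z ∈ traceEdges w T) :
      posEdge false a (f z) ∈ traceEdges w fun i k => f (T i k) := by
    rw [traceEdges_comp]
    have := Finset.mem_image_of_mem (Prod.map f (Prod.map id f)) h
    rwa [posEdge_map, show f u = false by simp [f]] at this
  refine ⟨_, _, a, hT.comp hf.2, ?_, ?_⟩
  · rw [traceEdges_comp]
    exact Finset.card_image_le.trans (by omega)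
  · have hne : f v ≠ f v' := fun h => hvv' (hf.1 h)
    have h₁ := hedge he
    have h₂ := hedge he'
    cases hv : f v <;> cases hv' : f v' <;> simp_all

end LoopGraph

end Folding

namespace WhiteheadDatum

variable {r : ℕ}

/-- An edge of the graph with vertices `false` and `true` whose only fold involves two edges
labelled `a`, from `false` to `false` and to `true`, where `A` is the set of labels of edges that
end at `true`. -/
def IsEdge (φ : WhiteheadDatum r) (s : Bool) (x : Letter r) (t : Bool) : Prop :=
  (x ≠ φ.1.1 → (t = true ↔ x ∈ φ.1.2)) ∧ (x.inv ≠ φ.1.1 → (s = true ↔ x.inv ∈ φ.1.2))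

/-- The edge labelled `a` from `false` to `true`, in one of its directions. -/
def IsFoldEdge (φ : WhiteheadDatum r) (s : Bool) (x : Letter r) (t : Bool) : Prop :=
  (x = φ.1.1 ∧ t = true) ∨ (x.inv = φ.1.1 ∧ s = true)

/-- The word `l` labels a path in the two-vertex graph of `φ` that is at the vertex `t k` at time
`k`. -/
def IsPath (φ : WhiteheadDatum r) (t : ℕ → Bool) (l : List (Letter r)) : Prop :=
  ∀ k, ∀ hk : k < l.length, φ.IsEdge (t k) l[k] (t (k + 1))

open Folding in
theorem exists_forall_isEdge {E : Finset (Bool × Fin r × Bool)} {a : Letter r}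
    (hstay : posEdge false a false ∈ E) (hcross : posEdge false a true ∈ E)
    (hlabel : ∀ j, ∃ e ∈ E, e.2.1 = j) (hcard : E.card ≤ r + 1) :
    ∃ φ : WhiteheadDatum r, φ.1.1 = a ∧ ∀ s x t, posEdge s x t ∈ E → φ.IsEdge s x t := by
  have hinj : Set.InjOn (fun e : Bool × Fin r × Bool => e.2.1) (E.erase (posEdge false a true)) :=
    injOn_erase_of_card_le_succ (t := Finset.univ) (fun _ _ => Finset.mem_coe.2 (Finset.mem_univ _))
      (fun j _ => hlabel j) (by simpa using hcard) hstay hcross (by simp [posEdge_inj])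
      (by simp only [posEdge_label])
  have hunique {s s' t t' : Bool} {x : Letter r} (h : posEdge s x t ∈ E) (h' : posEdge s' x t' ∈ E)
      (hne : posEdge s x t ≠ posEdge false a true) (hne' : posEdge s' x t' ≠ posEdge false a true) :
      s = s' ∧ t = t' := by
    rw [← posEdge_inj (x := x)]
    exact hinj (Finset.mem_coe.2 (Finset.mem_erase.2 ⟨hne, h⟩))
      (Finset.mem_coe.2 (Finset.mem_erase.2 ⟨hne', h'⟩)) (by simp only [posEdge_label])
  let A : Finset (Letter r) := {x | posEdge false x true ∈ E ∨ posEdge true x true ∈ E}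
  have hA (x : Letter r) : x ∈ A ↔ ∃ s, posEdge s x true ∈ E := by simp [A]
  have haA : a.inv ∉ A := by
    rw [hA]
    rintro ⟨s, hs⟩
    rw [posEdge_inv] at hs
    have := hunique hs hstay (by simp [posEdge_inj]) (by simp [posEdge_inj])
    simp at this
  have hne {s t : Bool} {x : Letter r} (hx : x ≠ a) (hx' : x ≠ a.inv) :
      posEdge s x t ≠ posEdge false a true := fun h => by
    have := congrArg (fun e => e.2.1) h
    simp only [posEdge_label] at this
    exact (Letter.eq_or_eq_inv this).elim hx hx'
  have hend {s t : Bool} {x : Letter r} (h : posEdge s x t ∈ E) (hx : x ≠ a) :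
      t = true ↔ x ∈ A := by
    refine ⟨fun ht => (hA x).2 ⟨s, ht ▸ h⟩, fun hxA => ?_⟩
    have hx' : x ≠ a.inv := fun h => haA (h ▸ hxA)
    obtain ⟨s', h'⟩ := (hA x).1 hxA
    exact (hunique h h' (hne hx hx') (hne hx hx')).2
  refine ⟨⟨(a, A), (hA a).2 ⟨false, hcross⟩, haA⟩, rfl, fun s x t h => ⟨hend h, hend (s := t) ?_⟩⟩
  rwa [posEdge_inv]

open Folding in
/-- The graph is the one before the last fold, whose result is a rose. -/
theorem exists_isPath_of_closure_eq_top [NeZero r] {w : Fin r → List (Letter r)}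
    (hne : ∀ i, w i ≠ []) (hlong : ∃ i, 2 ≤ (w i).length)
    (hw : Subgroup.closure (Set.range fun i => FreeGroup.mk (w i)) = ⊤) :
    ∃ (φ : WhiteheadDatum r) (T : Fin r → ℕ → Bool) (v₀ : Bool),
      (∀ i, φ.IsPath (T i) (w i)) ∧ (∀ i, T i 0 = v₀) ∧ (∀ i, T i (w i).length = v₀) ∧
      ∃ i k, ∃ hk : k < (w i).length, φ.IsFoldEdge (T i k) (w i)[k] (T i (k + 1)) := by
  obtain ⟨T, v₀, a, hT, hcard, hstay, hcross⟩ := exists_isLoops_bool hne hlong hw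
  obtain ⟨φ, rfl, hφ⟩ := exists_forall_isEdge hstay hcross
    (hT.exists_mem_traceEdges_label_eq hw) (by simpa using hcard)
  refine ⟨φ, T, v₀, fun i k hk => hφ _ _ _ (posEdge_mem_traceEdges i hk), hT.start, hT.finish, ?_⟩
  obtain ⟨i, k, hk, h⟩ := mem_traceEdges.1 hcross
  refine ⟨i, k, hk, ?_⟩
  have hlabel := congrArg (fun e => e.2.1) h
  simp only [posEdge_label] at hlabel
  rcases Letter.eq_or_eq_inv hlabel with hx | hx
  · rw [hx, posEdge_inj] at h
    exact .inl ⟨hx, h.2⟩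
  · rw [hx, posEdge_inv, posEdge_inj] at h
    exact .inr ⟨by rw [hx, Letter.inv_inv], h.2⟩

end WhiteheadDatum

/-! ### Whitehead automorphisms and primitive elements -/

namespace WhiteheadDatum

variable {r : ℕ} (φ : WhiteheadDatum r)

/-- The data of the inverse automorphism. -/
def symm : WhiteheadDatum r :=
  ⟨(φ.1.1.inv, insert φ.1.1.inv (φ.1.2.erase φ.1.1)), Finset.mem_insert_self _ _, by
    simp [(Letter.inv_ne φ.1.1).symm]⟩

theorem symm_symm : φ.symm.symm = φ := by
  obtain ⟨⟨a, A⟩, ha, ha'⟩ := φ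
  refine Subtype.ext (Prod.ext (Letter.inv_inv a) ?_)
  simp only [symm, Letter.inv_inv] at ha ha' ⊢
  rw [Finset.erase_insert (fun h => ha' (Finset.mem_of_mem_erase h)), Finset.insert_erase ha]

theorem hom_mk_fst : φ.hom (FreeGroup.mk [φ.1.1]) = FreeGroup.mk [φ.1.1] := by
  simp [hom_letter, tail, keep, φ.2.1, φ.2.2, ← FreeGroup.one_eq_mk]

theorem symm_hom_tail (x : Letter r) : φ.symm.hom (φ.tail x) = φ.tail x := by
  have ha : φ.symm.hom (FreeGroup.mk [φ.1.1]) = FreeGroup.mk [φ.1.1] := by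
    rw [← inv_inj, ← map_inv, ← mk_inv]
    exact φ.symm.hom_mk_fst
  unfold tail
  split_ifs
  · exact ha
  · exact map_one _

theorem symm_tail {x : Letter r} (hx : x.1 ≠ φ.1.1.1) : φ.symm.tail x = (φ.tail x)⁻¹ := by
  have hmem : x ∈ φ.symm.1.2 ↔ x ∈ φ.1.2 := by
    have hne : x ≠ φ.1.1 := fun h => hx (h ▸ rfl)
    have hne' : x ≠ φ.1.1.inv := fun h => hx (h ▸ rfl)
    simp [symm, hne, hne']
  unfold tail
  simp only [hmem]
  split_ifs
  · exact mk_inv φ.1.1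
  · exact inv_one.symm

theorem hom_of_eq {i : Fin r} (hi : i = φ.1.1.1) : φ.hom (FreeGroup.of i) = FreeGroup.of i := by
  rw [hom, FreeGroup.lift_apply_of, if_pos hi]

theorem hom_of_ne {i : Fin r} (hi : i ≠ φ.1.1.1) :
    φ.hom (FreeGroup.of i) =
      (φ.tail (i, false))⁻¹ * FreeGroup.of i * φ.tail (i, true) := by
  rw [hom, FreeGroup.lift_apply_of, if_neg hi]

theorem symm_hom_comp_hom : φ.symm.hom.comp φ.hom = MonoidHom.id _ := by
  ext i
  rw [MonoidHom.comp_apply, MonoidHom.id_apply]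
  by_cases hi : i = φ.1.1.1
  · rw [φ.hom_of_eq hi, φ.symm.hom_of_eq hi]
  · rw [φ.hom_of_ne hi, map_mul, map_mul, map_inv, symm_hom_tail, symm_hom_tail,
      φ.symm.hom_of_ne hi, symm_tail _ hi, symm_tail _ hi]
    group

/-- The endomorphism given by a Whitehead datum is an automorphism. -/
def equiv : FreeGroup (Fin r) ≃* FreeGroup (Fin r) :=
  MonoidHom.toMulEquiv φ.hom φ.symm.hom φ.symm_hom_comp_hom
    (by simpa only [symm_symm] using φ.symm.symm_hom_comp_hom)

theorem equiv_apply (g : FreeGroup (Fin r)) : φ.equiv g = φ.hom g := rfl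

end WhiteheadDatum

section Primitive

variable {r : ℕ} [NeZero r]

theorem isPrimitive_apply_iff (ψ : FreeGroup (Fin r) ≃* FreeGroup (Fin r))
    (g : FreeGroup (Fin r)) : IsPrimitive (ψ g) ↔ IsPrimitive g := by
  constructor
  · rintro ⟨χ, hχ⟩
    exact ⟨χ.trans ψ.symm, by simp [hχ]⟩
  · rintro ⟨χ, rfl⟩
    exact ⟨χ.trans ψ, rfl⟩

theorem isPrimitive_conj_iff (g h : FreeGroup (Fin r)) :
    IsPrimitive (g * h * g⁻¹) ↔ IsPrimitive h := by
  rw [← isPrimitive_apply_iff (MulAut.conj g) h, MulAut.conj_apply]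

theorem isPrimitive_mk_image_iff (φ : WhiteheadDatum r) (x : Letter r) (l : List (Letter r)) :
    IsPrimitive (FreeGroup.mk (φ.image x x l)) ↔ IsPrimitive (FreeGroup.mk (x :: l)) := by
  rw [WhiteheadDatum.mk_image, isPrimitive_conj_iff, ← WhiteheadDatum.equiv_apply,
    isPrimitive_apply_iff]

theorem not_isPrimitive_one : ¬ IsPrimitive (1 : FreeGroup (Fin r)) := by
  rintro ⟨χ, hχ⟩
  rw [map_eq_one_iff χ χ.injective] at hχ
  exact FreeGroup.of_ne_one _ hχ

theorem IsPrimitive.inv {g : FreeGroup (Fin r)} (h : IsPrimitive g) : IsPrimitive g⁻¹ := by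
  obtain ⟨χ, rfl⟩ := h
  let f : FreeGroup (Fin r) →* FreeGroup (Fin r) := FreeGroup.lift fun j => (FreeGroup.of j)⁻¹
  have hf : f.comp f = MonoidHom.id _ := by
    ext j
    simp [f]
  exact ⟨(MonoidHom.toMulEquiv f f hf hf).trans χ, by simp [f]⟩

theorem isPrimitive_mk_singleton (x : Letter r) : IsPrimitive (FreeGroup.mk [x]) := by
  have hof (i : Fin r) : IsPrimitive (FreeGroup.of i) :=
    ⟨FreeGroup.freeGroupCongr (Equiv.swap 0 i), by simp⟩
  obtain ⟨i, _ | _⟩ := x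
  · rw [show (i, false) = Letter.inv (i, true) from rfl, WhiteheadDatum.mk_inv]
    exact (hof i).inv
  · exact hof i

end Primitive

/-! ### Folding the last fold edge -/

namespace WhiteheadDatum

variable {r : ℕ} {φ : WhiteheadDatum r} {s t : Bool} {x y : Letter r}

instance : Decidable (φ.IsFoldEdge s x t) :=
  inferInstanceAs (Decidable (_ ∨ _))

/-- The word that is read along the path with vertices `t` when the fold edge, from `false` to
`true` with label `a`, is contracted. -/
def collapse (φ : WhiteheadDatum r) : (ℕ → Bool) → List (Letter r) → List (Letter r)
  | _, [] => []
  | t, x :: l =>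
    (if φ.IsFoldEdge (t 0) x (t 1) then [] else [x]) ++ φ.collapse (fun k => t (k + 1)) l

/-- The vertex `false` corresponds to `1` and the vertex `true` to `a`: along an edge labelled `x`
from `s` to `t`, the automorphism multiplies `x` by these elements. -/
def vertexElt (φ : WhiteheadDatum r) (s : Bool) : FreeGroup (Fin r) :=
  if s then FreeGroup.mk [φ.1.1] else 1

theorem IsEdge.cases (h : φ.IsEdge s x t) :
    (x = φ.1.1 ∧ s = false) ∨ (x = φ.1.1.inv ∧ t = false) ∨
      (x.1 ≠ φ.1.1.1 ∧ s = decide (x.inv ∈ φ.1.2) ∧ t = decide (x ∈ φ.1.2)) := by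
  have ha' := φ.2.2
  by_cases hx : x.1 = φ.1.1.1
  · rcases Letter.eq_or_eq_inv hx with rfl | rfl
    · exact .inl ⟨rfl, by simpa [ha'] using h.2 (Letter.inv_ne _)⟩
    · exact .inr (.inl ⟨rfl, by simpa [ha'] using h.1 (Letter.inv_ne _)⟩)
  · have hne : x ≠ φ.1.1 := fun h => hx (h ▸ rfl)
    have hne' : x.inv ≠ φ.1.1 := fun h => hx (h ▸ rfl)
    exact .inr (.inr ⟨hx, by simp [← h.2 hne'], by simp [← h.1 hne]⟩)

theorem not_isFoldEdge_of_ne (hx : x.1 ≠ φ.1.1.1) : ¬ φ.IsFoldEdge s x t := by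
  rintro (⟨h, -⟩ | ⟨h, -⟩)
  · exact hx (h ▸ rfl)
  · exact hx (h ▸ rfl)

theorem IsEdge.hom_eq (h : φ.IsEdge s x t) :
    φ.hom (FreeGroup.mk [x]) = (φ.vertexElt s)⁻¹ *
      FreeGroup.mk (if φ.IsFoldEdge s x t then [] else [x]) * φ.vertexElt t := by
  have ha := φ.2.1
  have ha' := φ.2.2
  rw [hom_letter]
  rcases h.cases with ⟨rfl, rfl⟩ | ⟨rfl, rfl⟩ | ⟨hx, rfl, rfl⟩
  · cases t <;> simp [tail, keep, vertexElt, IsFoldEdge, ha, ha', ← FreeGroup.one_eq_mk]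
  · have hkeep : φ.keep φ.1.1.inv = none := if_pos rfl
    cases s <;>
      simp [hkeep, tail, vertexElt, IsFoldEdge, ha, ha', mk_inv, ← FreeGroup.one_eq_mk]
  · rw [if_neg (not_isFoldEdge_of_ne hx)]
    simp [tail, keep, vertexElt, hx]

theorem IsPath.head {t : ℕ → Bool} {l : List (Letter r)} (h : φ.IsPath t (x :: l)) :
    φ.IsEdge (t 0) x (t 1) := h 0 (by simp)

theorem IsPath.tail {t : ℕ → Bool} {l : List (Letter r)} (h : φ.IsPath t (x :: l)) :
    φ.IsPath (fun k => t (k + 1)) l := fun k hk => h (k + 1) (by simpa using hk)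

theorem IsPath.hom_eq {t : ℕ → Bool} {l : List (Letter r)} (h : φ.IsPath t l) :
    φ.hom (FreeGroup.mk l) =
      (φ.vertexElt (t 0))⁻¹ * FreeGroup.mk (φ.collapse t l) * φ.vertexElt (t l.length) := by
  induction l generalizing t with
  | nil => simp [collapse, ← FreeGroup.one_eq_mk]
  | cons x l ih =>
    rw [mk_cons, map_mul, ih h.tail, h.head.hom_eq, collapse, ← FreeGroup.mul_mk]
    simp only [List.length_cons, zero_add]
    group

theorem collapse_sublist (φ : WhiteheadDatum r) (t : ℕ → Bool) (l : List (Letter r)) :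
    (φ.collapse t l).Sublist l := by
  induction l generalizing t with
  | nil => exact List.Sublist.slnil
  | cons x l ih =>
    rw [collapse]
    split_ifs
    · exact (ih _).cons x
    · exact (ih _).cons_cons x

theorem collapse_eq_self_iff {t : ℕ → Bool} {l : List (Letter r)} :
    φ.collapse t l = l ↔ ∀ k, ∀ hk : k < l.length, ¬ φ.IsFoldEdge (t k) l[k] (t (k + 1)) := by
  induction l generalizing t with
  | nil => simp [collapse]
  | cons x l ih =>
    have hforall : (∀ k, ∀ hk : k < (x :: l).length, ¬ φ.IsFoldEdge (t k) (x :: l)[k] (t (k + 1))) ↔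
        ¬ φ.IsFoldEdge (t 0) x (t 1) ∧
          ∀ k, ∀ hk : k < l.length, ¬ φ.IsFoldEdge (t (k + 1)) l[k] (t (k + 2)) := by
      refine ⟨fun h => ⟨h 0 (by simp), fun k hk => h (k + 1) (by simpa using hk)⟩, ?_⟩
      rintro ⟨h₀, h⟩ (_ | k) hk
      · exact h₀
      · exact h k (by simpa using hk)
    rw [hforall, ← ih, collapse]
    split_ifs with h₀
    · have := (φ.collapse_sublist (fun k => t (k + 1)) l).length_le
      simp only [List.nil_append, h₀, not_true_eq_false, false_and, iff_false]
      intro h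
      simp [h] at this
    · simp [h₀]

theorem collapse_length_lt {t : ℕ → Bool} {l : List (Letter r)}
    (h : ∃ k, ∃ hk : k < l.length, φ.IsFoldEdge (t k) l[k] (t (k + 1))) :
    (φ.collapse t l).length < l.length := by
  refine lt_of_le_of_ne (φ.collapse_sublist t l).length_le fun heq => ?_
  obtain ⟨k, hk, hfold⟩ := h
  exact collapse_eq_self_iff.1 ((φ.collapse_sublist t l).eq_of_length heq) k hk hfold

/-- The only letter `y` at the vertex `false` with `y⁻¹ ∈ A` is `a⁻¹`. It survives in the collapsed
word; in `WhiteheadDatum.image` it is deleted, but an `a⁻¹` is inserted in front of it. This is the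
number of letters inserted in front of `y` on that account. -/
def insertedBefore (φ : WhiteheadDatum r) (s : Bool) (y : Letter r) : ℕ :=
  if y.inv ∈ φ.1.2 ∧ s = false then 1 else 0

theorem IsEdge.inv_mem (h : φ.IsEdge true x t) : x.inv ∈ φ.1.2 := by
  by_cases hx : x.inv = φ.1.1
  · exact hx ▸ φ.2.1
  · exact (h.2 hx).1 rfl

theorem IsEdge.keep_glue_length_le (hx : φ.IsEdge s x t) (hy : t = true → y.inv ∈ φ.1.2) :
    (φ.keep x).toList.length + (φ.glue x y).toList.length + φ.insertedBefore s x ≤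
      (if φ.IsFoldEdge s x t then [] else [x]).length + φ.insertedBefore t y := by
  have ha := φ.2.1
  have ha' := φ.2.2
  rcases hx.cases with ⟨rfl, rfl⟩ | ⟨rfl, rfl⟩ | ⟨hne, rfl, rfl⟩
  · have hkeep : φ.keep φ.1.1 = none := if_pos rfl
    by_cases hmem : y.inv ∈ φ.1.2 <;> cases t <;>
      simp_all [glue, insertedBefore, IsFoldEdge]
  · have hkeep : φ.keep φ.1.1.inv = none := if_pos rfl
    by_cases hmem : y.inv ∈ φ.1.2 <;> cases s <;>
      simp_all [glue, insertedBefore, IsFoldEdge]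
  · rw [if_neg (not_isFoldEdge_of_ne hne)]
    by_cases hmem : y.inv ∈ φ.1.2 <;> by_cases hxmem : x ∈ φ.1.2 <;>
      simp_all [glue, keep, insertedBefore]

theorem IsPath.image_length_le {t : ℕ → Bool} {f : Letter r} {l : List (Letter r)}
    (h : φ.IsPath t (x :: l)) (hf : t (l.length + 1) = true → f.inv ∈ φ.1.2) :
    (φ.image f x l).length + φ.insertedBefore (t 0) x ≤
      (φ.collapse t (x :: l)).length + φ.insertedBefore (t (l.length + 1)) f := by
  induction l generalizing t x with
  | nil => simpa [image, collapse] using h.head.keep_glue_length_le hf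
  | cons y l ih =>
    have hhead := h.head.keep_glue_length_le (y := y) fun ht => (ht ▸ h.tail.head).inv_mem
    have htail := ih h.tail hf
    rw [image, collapse]
    simp only [List.length_append, List.length_cons, zero_add] at hhead htail ⊢
    omega

theorem IsPath.image_length_lt {t : ℕ → Bool} {l : List (Letter r)} (h : φ.IsPath t (x :: l))
    (ht : t (l.length + 1) = t 0)
    (hfold : ∃ k, ∃ hk : k < (x :: l).length, φ.IsFoldEdge (t k) (x :: l)[k] (t (k + 1))) :
    (φ.image x x l).length < (x :: l).length := by
  have hle := h.image_length_le (f := x) fun ht' => ((ht.symm.trans ht') ▸ h.head).inv_mem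
  have hlt := collapse_length_lt hfold
  rw [ht] at hle
  omega

end WhiteheadDatum

section Reduction

variable {r : ℕ} [NeZero r]

/-- Words for the images of the generators under `χ`: the word `u` for the first generator, and
reduced words for the others. -/
def basisWords (χ : FreeGroup (Fin r) ≃* FreeGroup (Fin r)) (u : List (Letter r)) :
    Fin r → List (Letter r) :=
  Function.update (fun i => (χ (FreeGroup.of i)).toWord) 0 u

/-- The total length of the images of the generators other than the first one. -/
def restNorm (χ : FreeGroup (Fin r) ≃* FreeGroup (Fin r)) : ℕ :=
  ∑ i ∈ Finset.univ.erase 0, (χ (FreeGroup.of i)).norm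

variable {χ : FreeGroup (Fin r) ≃* FreeGroup (Fin r)} {u : List (Letter r)}

theorem mk_basisWords (hχ : χ (FreeGroup.of 0) = FreeGroup.mk u) (i : Fin r) :
    FreeGroup.mk (basisWords χ u i) = χ (FreeGroup.of i) := by
  obtain rfl | hi := eq_or_ne i 0
  · rw [basisWords, Function.update_self, hχ]
  · rw [basisWords, Function.update_of_ne hi, FreeGroup.mk_toWord]

theorem basisWords_ne_nil (hχ : χ (FreeGroup.of 0) = FreeGroup.mk u) (i : Fin r) :
    basisWords χ u i ≠ [] := by
  intro hnil
  have hone := mk_basisWords hχ i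
  rw [hnil, ← FreeGroup.one_eq_mk, eq_comm, map_eq_one_iff χ χ.injective] at hone
  exact FreeGroup.of_ne_one _ hone

theorem closure_range_mk_basisWords (hχ : χ (FreeGroup.of 0) = FreeGroup.mk u) :
    Subgroup.closure (Set.range fun i => FreeGroup.mk (basisWords χ u i)) = ⊤ := by
  rw [funext fun i => mk_basisWords hχ i]
  have hmap := MonoidHom.map_closure χ.toMonoidHom (Set.range FreeGroup.of)
  rw [FreeGroup.closure_range_of, ← Set.range_comp] at hmap
  exact hmap.symm.trans (Subgroup.map_top_of_surjective _ χ.surjective)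

/-- If the fold involves none of the edges of the loop `u`, then it makes the other elements of the
basis shorter. -/
theorem exists_isPath_or_restNorm_lt (hχ : χ (FreeGroup.of 0) = FreeGroup.mk u)
    (hu : 2 ≤ u.length) :
    (∃ (φ : WhiteheadDatum r) (t : ℕ → Bool), φ.IsPath t u ∧ t u.length = t 0 ∧
      ∃ k, ∃ hk : k < u.length, φ.IsFoldEdge (t k) u[k] (t (k + 1))) ∨
    ∃ χ' : FreeGroup (Fin r) ≃* FreeGroup (Fin r),
      χ' (FreeGroup.of 0) = FreeGroup.mk u ∧ restNorm χ' < restNorm χ := by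
  have hzero : basisWords χ u 0 = u := Function.update_self ..
  obtain ⟨φ, T, v₀, hT, hstart, hfinish, i, hfold⟩ :=
    WhiteheadDatum.exists_isPath_of_closure_eq_top (basisWords_ne_nil hχ) ⟨0, hzero.symm ▸ hu⟩
      (closure_range_mk_basisWords hχ)
  by_cases hu_fold : ∃ k, ∃ hk : k < u.length, φ.IsFoldEdge (T 0 k) u[k] (T 0 (k + 1))
  · exact .inl ⟨φ, T 0, hzero ▸ hT 0, by rw [hstart, ← hfinish 0, hzero], hu_fold⟩
  let χ' := (χ.trans φ.equiv).trans (MulAut.conj (φ.vertexElt v₀))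
  have hχ' (j : Fin r) :
      χ' (FreeGroup.of j) = FreeGroup.mk (φ.collapse (T j) (basisWords χ u j)) := by
    have hom_eq := (hT j).hom_eq
    rw [hstart, hfinish, mk_basisWords hχ] at hom_eq
    simp only [χ', MulEquiv.trans_apply, MulAut.conj_apply, WhiteheadDatum.equiv_apply, hom_eq]
    group
  have hi : i ≠ 0 := by
    rintro rfl
    simp only [hzero] at hfold
    exact hu_fold hfold
  have hnorm (j : Fin r) (hj : j ∈ Finset.univ.erase 0) :
      (χ (FreeGroup.of j)).norm = (basisWords χ u j).length := by
    rw [basisWords, Function.update_of_ne (Finset.ne_of_mem_erase hj), FreeGroup.norm]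
  refine .inr ⟨χ', ?_, Finset.sum_lt_sum (fun j hj => ?_) ⟨i, by simp [hi], ?_⟩⟩
  · push Not at hu_fold
    rw [hχ', hzero, WhiteheadDatum.collapse_eq_self_iff.2 hu_fold]
  · rw [hnorm j hj, hχ']
    exact FreeGroup.norm_mk_le.trans (φ.collapse_sublist _ _).length_le
  · rw [hnorm i (by simp [hi]), hχ']
    exact FreeGroup.norm_mk_le.trans_lt (WhiteheadDatum.collapse_length_lt hfold)

theorem IsPrimitive.exists_isPath (h : IsPrimitive (FreeGroup.mk u)) (hu : 2 ≤ u.length) :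
    ∃ (φ : WhiteheadDatum r) (t : ℕ → Bool), φ.IsPath t u ∧ t u.length = t 0 ∧
      ∃ k, ∃ hk : k < u.length, φ.IsFoldEdge (t k) u[k] (t (k + 1)) := by
  obtain ⟨χ, hχ⟩ := h
  induction hn : restNorm χ using Nat.strong_induction_on generalizing χ with
  | _ n ih =>
    rcases exists_isPath_or_restNorm_lt hχ hu with hpath | ⟨χ', hχ', hlt⟩
    · exact hpath
    · exact ih _ (hn ▸ hlt) χ' hχ' rfl

theorem IsPrimitive.exists_image_length_lt {x : Letter r} {l : List (Letter r)} (hl : l ≠ [])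
    (h : IsPrimitive (FreeGroup.mk (x :: l))) :
    ∃ φ : WhiteheadDatum r, (φ.image x x l).length < (x :: l).length := by
  obtain ⟨φ, t, hpath, hclosed, hfold⟩ :=
    h.exists_isPath (Nat.succ_le_succ (List.length_pos_iff.2 hl))
  exact ⟨φ, hpath.image_length_lt hclosed hfold⟩

end Reduction

/-! ### The Whitehead graph of a primitive word -/

section WhiteheadGraph

variable {r : ℕ}

theorem Letter.ne_inv_iff {x y : Letter r} : y ≠ x.inv ↔ (x.1 = y.1 → x.2 = y.2) := by
  obtain ⟨i, b⟩ := x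
  obtain ⟨j, c⟩ := y
  cases b <;> cases c <;> simp [Letter.inv, eq_comm]

namespace WhiteheadDatum

variable {φ : WhiteheadDatum r} {s t : Bool} {x : Letter r}

theorem IsEdge.eq_of_forall_mem_eq (h : φ.IsEdge s x t) (hA : ∀ q ∈ φ.1.2, q = φ.1.1) :
    (t = true → x = φ.1.1) ∧ (s = true → x.inv = φ.1.1) :=
  ⟨fun ht => by_contra fun hx => hx (hA _ ((h.1 hx).1 ht)),
    fun hs => by_contra fun hx => hx (hA _ ((h.2 hx).1 hs))⟩

/-- If `A` contains only `a`, then a path through the vertex `true` arrives there along `a` and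
leaves along `a⁻¹`. -/
theorem IsPath.eq_false_of_forall_mem_eq {t : ℕ → Bool} {u : List (Letter r)} (h : φ.IsPath t u)
    (hclosed : t u.length = t 0) (hu : FreeGroup.IsCyclicallyReduced u)
    (hA : ∀ q ∈ φ.1.2, q = φ.1.1) {k : ℕ} (hk : k ≤ u.length) (hpos : 0 < u.length) :
    t k = false := by
  by_contra htk
  rw [Bool.not_eq_false] at htk
  have hleave (j : ℕ) (hj : j < u.length) (ht : t j = true) : u[j].inv = φ.1.1 :=
    ((h j hj).eq_of_forall_mem_eq hA).2 ht
  have harrive (j : ℕ) (hj : j < u.length) (ht : t (j + 1) = true) : u[j] = φ.1.1 :=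
    ((h j hj).eq_of_forall_mem_eq hA).1 ht
  have habsurd (x y : Letter r) (hx : x = φ.1.1) (hy : y.inv = φ.1.1) :
      ¬ (x.1 = y.1 → x.2 = y.2) := by
    rw [← Letter.ne_inv_iff, not_not, hx, ← hy, Letter.inv_inv]
  by_cases hmid : 0 < k ∧ k < u.length
  · obtain ⟨j, rfl⟩ := Nat.exists_eq_succ_of_ne_zero hmid.1.ne'
    exact habsurd _ _ (harrive j (by omega) htk) (hleave (j + 1) hmid.2 htk)
      (List.isChain_iff_getElem.1 hu.isReduced j hmid.2)
  · have ht0 : t 0 = true := by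
      obtain rfl | rfl : k = 0 ∨ k = u.length := by omega
      exacts [htk, hclosed ▸ htk]
    have hlast : t (u.length - 1 + 1) = true := by
      rw [Nat.sub_add_cancel hpos, hclosed, ht0]
    exact habsurd _ _ (harrive (u.length - 1) (by omega) hlast) (hleave 0 hpos ht0)
      (hu.2 _ (by simp [List.getLast?_eq_getElem?]) _ (by simp [List.head?_eq_getElem?]))

theorem IsPath.exists_vertex_between {t : ℕ → Bool} {u : List (Letter r)} (h : φ.IsPath t u)
    {x y : Letter r} (hxy : [x, y] <:+: u) :
    ∃ m : Bool, (x ≠ φ.1.1 → (m = true ↔ x ∈ φ.1.2)) ∧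
      (y.inv ≠ φ.1.1 → (m = true ↔ y.inv ∈ φ.1.2)) := by
  obtain ⟨l₁, l₂, rfl⟩ := hxy
  exact ⟨t (l₁.length + 1), by simpa using (h l₁.length (by simp)).1,
    by simpa using (h (l₁.length + 1) (by simp)).2⟩

end WhiteheadDatum

/-- The edges of the Whitehead graph (without the external edge) of a word. -/
def whiteheadEdges (l : List (Letter r)) : Finset (Sym2 (Letter r)) :=
  ({p | [p.1, p.2] <:+: l} : Finset (Letter r × Letter r)).image fun p => s(p.1, p.2.inv)

theorem mem_whiteheadEdges {l : List (Letter r)} {p : Sym2 (Letter r)} :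
    p ∈ whiteheadEdges l ↔ ∃ x y, [x, y] <:+: l ∧ s(x, y.inv) = p := by
  simp [whiteheadEdges]

theorem whiteheadEdges_mono {l l' : List (Letter r)} (h : l <:+: l') :
    whiteheadEdges l ⊆ whiteheadEdges l' :=
  Finset.image_subset_image fun p hp => by
    simp only [Finset.mem_filter_univ] at hp ⊢
    exact hp.trans h

@[simp]
theorem whiteheadEdges_nil : whiteheadEdges ([] : List (Letter r)) = ∅ := by
  simp [whiteheadEdges]

theorem addEdge_whiteheadEdges (l : List (Letter r)) (y : Letter r) :
    addEdge (whiteheadEdges l) l.getLast? y = whiteheadEdges (l ++ [y]) := by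
  ext p
  rcases List.eq_nil_or_concat l with rfl | ⟨l, x, rfl⟩
  · simp [addEdge, mem_whiteheadEdges, List.infix_cons_iff]
  · have hsuffix (a b : Letter r) : [a, b] <:+ l ++ [x] ++ [y] ↔ a = x ∧ b = y :=
      ⟨fun ⟨w, hw⟩ => by
          simpa using (List.append_inj' (hw.trans (List.append_assoc l [x] [y])) rfl).2,
        fun ⟨hax, hby⟩ => ⟨l, by simp [hax, hby]⟩⟩
    simp only [List.concat_eq_append, List.getLast?_concat, addEdge, Finset.mem_insert,
      mem_whiteheadEdges, List.infix_concat_iff (l₂ := l ++ [x]), hsuffix, or_and_right, exists_or,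
      exists_and_left, and_assoc, exists_eq_left, eq_comm (a := p)]

/-- The Whitehead graph (without the external edge) of the word is complete. -/
abbrev HasCompleteGraph (l : List (Letter r)) : Prop := IsCompleteGraph (whiteheadEdges l)

namespace HasCompleteGraph

theorem mono {l l' : List (Letter r)} (h : HasCompleteGraph l) (hl : l <:+: l') :
    HasCompleteGraph l' :=
  fun x y hxy => whiteheadEdges_mono hl (h x y hxy)

theorem two_le_length [NeZero r] {l : List (Letter r)} (h : HasCompleteGraph l) :
    2 ≤ l.length := by
  obtain ⟨x, y, hxy, -⟩ := mem_whiteheadEdges.1 (h (0, true) (0, false) (by simp))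
  exact hxy.length_le

theorem not_isPrimitive [NeZero r] {u : List (Letter r)} (h : HasCompleteGraph u)
    (hu : FreeGroup.IsCyclicallyReduced u) : ¬ IsPrimitive (FreeGroup.mk u) := by
  intro hprim
  obtain ⟨φ, t, hpath, hclosed, k, hk, hfold⟩ := hprim.exists_isPath h.two_le_length
  obtain ⟨q, hq, hqa⟩ : ∃ q ∈ φ.1.2, q ≠ φ.1.1 := by
    by_contra! hA
    have hfalse {j : ℕ} (hj : j ≤ u.length) : t j = false :=
      hpath.eq_false_of_forall_mem_eq hclosed hu hA hj (by omega)
    simp [WhiteheadDatum.IsFoldEdge, hfalse hk.le, hfalse (Nat.succ_le_of_lt hk)] at hfold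
  -- `q` and `a⁻¹` are not adjacent: an edge would be a vertex of the path in and outside `A`.
  have ha' := φ.2.2
  obtain ⟨x, y, hxy, hedge⟩ := mem_whiteheadEdges.1 (h φ.1.1.inv q fun h => ha' (h ▸ hq))
  obtain ⟨m, hx, hy⟩ := hpath.exists_vertex_between hxy
  rcases Sym2.eq_iff.1 hedge with ⟨rfl, rfl⟩ | ⟨rfl, hya⟩
  · exact ha' ((hx (Letter.inv_ne _)).1 ((hy hqa).2 hq))
  · rw [hya] at hy
    exact ha' ((hy (Letter.inv_ne _)).1 ((hx hqa).2 hq))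

end HasCompleteGraph

end WhiteheadGraph

/-! ### Runs of a machine -/

section Runs

variable {σ : Type} {step : σ → Bool ⊕ σ}

/-- The machine goes from `c` to `c'` in `t` steps. -/
def Runs (step : σ → Bool ⊕ σ) (t : ℕ) (c c' : σ) : Prop :=
  ∀ n, answerWithin step (n + t) c = answerWithin step n c'

theorem Runs.trans {t t' : ℕ} {c c' c'' : σ} (h : Runs step t c c') (h' : Runs step t' c' c'') :
    Runs step (t' + t) c c'' := fun n => by
  rw [← add_assoc, h, h']

theorem Runs.single {c c' : σ} (h : step c = Sum.inr c') : Runs step 1 c c' := fun n => by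
  rw [answerWithin, h]

theorem Runs.head {t : ℕ} {c c' c'' : σ} (h : step c = Sum.inr c') (h' : Runs step t c' c'') :
    Runs step (t + 1) c c'' :=
  (Runs.single h).trans h'

theorem Runs.cast {t t' : ℕ} {c c' : σ} (h : Runs step t c c') (ht : t = t') :
    Runs step t' c c' := ht ▸ h

theorem answerWithin_one {c : σ} {b : Bool} (h : step c = Sum.inl b) :
    answerWithin step 1 c = some b := by
  rw [answerWithin, h]

theorem answerWithin_add {t : ℕ} {c : σ} {b : Bool} (h : answerWithin step t c = some b) (n : ℕ) :
    answerWithin step (t + n) c = some b := by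
  induction t generalizing c with
  | zero => simp [answerWithin] at h
  | succ t ih =>
    rw [Nat.succ_add_eq_add_succ, Nat.add_succ]
    rw [answerWithin] at h ⊢
    cases hs : step c with
    | inl a => rwa [hs] at h
    | inr c' =>
      rw [hs] at h
      exact ih h

theorem answerWithin_mono {t t' : ℕ} {c : σ} {b : Bool} (h : answerWithin step t c = some b)
    (ht : t ≤ t') : answerWithin step t' c = some b := by
  obtain ⟨n, rfl⟩ := Nat.exists_eq_add_of_le ht
  exact answerWithin_add h n

theorem Runs.answerWithin {t n m : ℕ} {c c' : σ} {b : Bool} (h : Runs step t c c')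
    (h' : answerWithin step n c' = some b) (hm : n + t ≤ m) : answerWithin step m c = some b :=
  answerWithin_mono ((h n).trans h') hm

theorem stepCount_le {t : ℕ} {c : σ} {b : Bool} (h : answerWithin step t c = some b) :
    stepCount step c ≤ t :=
  iInf₂_le t (by rw [h]; rfl)

end Runs

/-! ### Tapes that contain a word -/

namespace WordTape

open Turing

variable {Γ : Type} (L R : List Γ) (x : Γ)

/-- The tape with the word `L.reverse ++ R`, delimited by blanks, and the head on the first letter
of `R`, or behind the word. -/
def tapeAt : Tape (Option Γ) :=
  Tape.mk' (ListBlank.mk (L.map some)) (ListBlank.mk (R.map some))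

/-- The tape with the word `L.reverse ++ R`, delimited by blanks, and the head on the last letter of
`L`, or in front of the word. -/
def tapeBefore : Tape (Option Γ) := (tapeAt L R).move .left

theorem cons_none_mk_nil : ListBlank.cons none (ListBlank.mk ([] : List (Option Γ))) =
    ListBlank.mk [] :=
  ListBlank.cons_head_tail (ListBlank.mk ([] : List (Option Γ)))

@[simp]
theorem tapeAt_head_nil : (tapeAt L []).head = none := rfl

@[simp]
theorem tapeAt_head_cons : (tapeAt L (x :: R)).head = some x := rfl

@[simp]
theorem tapeAt_move_left : (tapeAt L R).move .left = tapeBefore L R := rfl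

@[simp]
theorem tapeAt_move_right : (tapeAt L (x :: R)).move .right = tapeAt (x :: L) R := by
  rw [tapeAt, Tape.move_right_mk']
  rfl

theorem tapeBefore_cons : tapeBefore (x :: L) R = tapeAt L (x :: R) := by
  rw [tapeBefore, tapeAt, Tape.move_left_mk']
  rfl

theorem tapeBefore_nil_nil : tapeBefore ([] : List Γ) [] = tapeAt [] [] := by
  rw [tapeBefore, tapeAt, Tape.move_left_mk']
  exact congrArg _ cons_none_mk_nil

@[simp]
theorem tapeBefore_head_nil : (tapeBefore [] R).head = none := rfl

@[simp]
theorem tapeBefore_head_cons : (tapeBefore (x :: L) R).head = some x := rfl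

@[simp]
theorem tapeBefore_move_right : (tapeBefore L R).move .right = tapeAt L R :=
  Tape.move_left_right _

@[simp]
theorem tapeBefore_move_left : (tapeBefore (x :: L) R).move .left = tapeBefore L (x :: R) := by
  rw [tapeBefore_cons, tapeAt_move_left]

@[simp]
theorem tapeAt_write_move_right :
    ((tapeAt L []).write (some x)).move .right = tapeAt (x :: L) [] := by
  rw [tapeAt, Tape.write_mk', Tape.move_right_mk']
  rfl

@[simp]
theorem tapeBefore_write_none_move_left :
    ((tapeBefore (x :: L) []).write none).move .left = tapeBefore L [] := by
  rw [tapeBefore_cons, tapeAt, Tape.write_mk']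
  exact congrArg (fun l => (Tape.mk' _ l).move .left) cons_none_mk_nil

@[simp]
theorem tapeAt_write_none : (tapeAt L []).write none = tapeAt L [] :=
  Tape.write_self (tapeAt L [])

@[simp]
theorem tapeAt_write_some : (tapeAt L (x :: R)).write (some x) = tapeAt L (x :: R) :=
  Tape.write_self (tapeAt L (x :: R))

@[simp]
theorem tapeBefore_write_none : (tapeBefore [] R).write none = tapeBefore [] R :=
  Tape.write_self (tapeBefore [] R)

@[simp]
theorem tapeBefore_write_some :
    (tapeBefore (x :: L) R).write (some x) = tapeBefore (x :: L) R :=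
  Tape.write_self (tapeBefore (x :: L) R)

end WordTape

/-! ### The run of the Whitehead algorithm -/

namespace AlgorithmA

open Turing WordTape

variable {r : ℕ}

/-- The three tapes, given the input tape `T`, the tape `C` with the current word and the tape `I`
with its image. -/
def tapes (b : Bool) (T C I : Tape (Option (Letter r))) : Fin 3 → Tape (Option (Letter r)) :=
  Function.update (Function.update (fun _ => T) (curTape b) C) (imgTape b) I

section Tapes

variable (b : Bool) (T C I : Tape (Option (Letter r)))

theorem curTape_ne_imgTape : curTape b ≠ imgTape b := by cases b <;> decide

@[simp]
theorem tapes_curTape : tapes b T C I (curTape b) = C := by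
  simp [tapes, curTape_ne_imgTape]

@[simp]
theorem tapes_imgTape : tapes b T C I (imgTape b) = I := by
  simp [tapes]

@[simp]
theorem tapes_zero : tapes b T C I 0 = T := by
  cases b <;> rfl

@[simp]
theorem update_curTape (C' : Tape (Option (Letter r))) :
    Function.update (tapes b T C I) (curTape b) C' = tapes b T C' I := by
  rw [tapes, Function.update_comm (curTape_ne_imgTape b).symm, Function.update_idem, tapes]

@[simp]
theorem update_imgTape (I' : Tape (Option (Letter r))) :
    Function.update (tapes b T C I) (imgTape b) I' = tapes b T C I' := by
  rw [tapes, Function.update_idem, tapes]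

@[simp]
theorem update_zero (T' : Tape (Option (Letter r))) :
    Function.update (tapes b T C I) 0 T' = tapes b T' C I := by
  funext j
  cases b <;> fin_cases j <;> rfl

theorem tapes_not : tapes (!b) T C I = tapes b T I C := by
  funext j
  cases b <;> fin_cases j <;> rfl

end Tapes

section Step

/-- The configurations of the algorithm. -/
abbrev Config (r : ℕ) : Type := AState r × (Fin 3 → Tape (Option (Letter r)))

variable (tp : Fin 3 → Tape (Option (Letter r))) (act : Fin 3 → Option (Letter r) × Option Dir)

/-- The result of the actions `act` on the tapes `tp`. -/
def applyActs (j : Fin 3) : Tape (Option (Letter r)) :=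
  TuringMachine.applyAct (tp j) (act j)

@[simp]
theorem applyActs_idle : applyActs tp (fun j => ((tp j).head, none)) = tp :=
  funext fun _ => Tape.write_self _

@[simp]
theorem applyActs_onTape (j : Fin 3) (c : Option (Letter r)) (d : Dir) :
    applyActs tp (onTape act j c (some d)) =
      Function.update (applyActs tp act) j (((tp j).write c).move d) := by
  funext k
  by_cases hk : k = j
  · subst hk
    simp [applyActs, onTape, TuringMachine.applyAct]
  · simp [applyActs, onTape, hk]

/-- A step of the algorithm. -/
def aStep (e : Fin (numWhitehead r) ≃ WhiteheadDatum r) (c : Config r) : Bool ⊕ Config r :=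
  (algorithmA e).step c

theorem aStep_eq (e : Fin (numWhitehead r) ≃ WhiteheadDatum r) (q : AState r) :
    aStep e (q, tp) = (aTrans e q fun j => (tp j).head).map id
      (Prod.map id (applyActs tp)) := by
  simp only [aStep, TuringMachine.step, algorithmA]
  cases aTrans e q fun j => (tp j).head <;> rfl

end Step

section Runs

variable (e : Fin (numWhitehead r) ≃ WhiteheadDatum r) (b : Bool)
  (T C I : Tape (Option (Letter r)))

theorem runs_rewind (i : Fin (numWhitehead r + 1)) (L R : List (Letter r)) :
    Runs (aStep e) (L.length + 1) (.rewind b i, tapes b T (tapeBefore L R) I)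
      (.begins b i, tapes b T (tapeAt [] (L.reverse ++ R)) I) := by
  induction L generalizing R with
  | nil => exact Runs.single (by simp [aStep_eq, aTrans])
  | cons x L ih =>
    rw [List.reverse_cons, List.append_assoc]
    exact Runs.head (by simp [aStep_eq, aTrans]) (ih (x :: R))

theorem aStep_keep (i : Fin (numWhitehead r)) (f x : Letter r) (L R J : List (Letter r)) :
    aStep e (.keep b i f x, tapes b T (tapeAt L R) (tapeAt J [])) =
      .inr (.glue b i f x,
        tapes b T (tapeAt L R) (tapeAt (((e i).keep x).toList.reverse ++ J) [])) := by
  cases hkeep : (e i).keep x <;> simp [aStep_eq, aTrans, appendTo, hkeep]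

theorem aStep_glue_cons (i : Fin (numWhitehead r)) (f x y : Letter r) (L R J : List (Letter r)) :
    aStep e (.glue b i f x, tapes b T (tapeAt L (y :: R)) (tapeAt J [])) =
      .inr (.keep b i f y,
        tapes b T (tapeAt (y :: L) R) (tapeAt (((e i).glue x y).toList.reverse ++ J) [])) := by
  cases hglue : (e i).glue x y <;> simp [aStep_eq, aTrans, appendTo, hglue]

theorem aStep_glue_nil (i : Fin (numWhitehead r)) (f x : Letter r) (L J : List (Letter r)) :
    aStep e (.glue b i f x, tapes b T (tapeAt L []) (tapeAt J [])) =
      .inr (.turn b i,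
        tapes b T (tapeAt L []) (tapeAt (((e i).glue x f).toList.reverse ++ J) [])) := by
  cases hglue : (e i).glue x f <;> simp [aStep_eq, aTrans, appendTo, hglue]

theorem runs_image (i : Fin (numWhitehead r)) (f x : Letter r) (L R J : List (Letter r)) :
    Runs (aStep e) (2 * (R.length + 1)) (.keep b i f x, tapes b T (tapeAt L R) (tapeAt J []))
      (.turn b i, tapes b T (tapeAt (R.reverse ++ L) [])
        (tapeAt (((e i).image f x R).reverse ++ J) [])) := by
  induction R generalizing x L J with
  | nil =>
    simpa [WhiteheadDatum.image] using
      Runs.head (aStep_keep e b T i f x L [] J) (Runs.single (aStep_glue_nil e b T i f x L _))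
  | cons y R ih =>
    exact Runs.head (aStep_keep e b T i f x L (y :: R) J) <|
      Runs.head (aStep_glue_cons e b T i f x y L R _) <| by
        simpa [WhiteheadDatum.image] using ih y (y :: L) _

theorem runs_seek (i : Fin (numWhitehead r + 1)) (L R : List (Letter r)) :
    Runs (aStep e) (R.length + 1) (.seek b i, tapes b T C (tapeAt L R))
      (.wipe b i, tapes b T C (tapeBefore (R.reverse ++ L) [])) := by
  induction R generalizing L with
  | nil => exact Runs.single (by simp [aStep_eq, aTrans])
  | cons x R ih =>
    rw [List.reverse_cons, List.append_assoc]
    exact Runs.head (by simp [aStep_eq, aTrans]) (ih (x :: L))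

theorem runs_wipe (i : Fin (numWhitehead r + 1)) (L : List (Letter r)) :
    Runs (aStep e) (L.length + 1) (.wipe b i, tapes b T C (tapeBefore L []))
      (.rewind b i, tapes b T C (tapeAt [] [])) := by
  induction L with
  | nil => exact Runs.single (by simp [aStep_eq, aTrans, tapeBefore_nil_nil])
  | cons x L ih => exact Runs.head (by simp [aStep_eq, aTrans]) ih

theorem runs_seek_to_begins (i : Fin (numWhitehead r + 1)) (L R w : List (Letter r)) :
    Runs (aStep e) (2 * R.length + L.length + 3)
      (.seek b i, tapes b T (tapeBefore [] w) (tapeAt L R))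
      (.begins b i, tapes b T (tapeAt [] w) (tapeAt [] [])) := by
  refine (((runs_seek e b T (tapeBefore [] w) i L R).trans (runs_wipe e b T _ i _)).trans
    (runs_rewind e b T _ i [] w)).cast ?_
  simp only [List.length_nil, List.length_append, List.length_reverse]
  omega

theorem runs_compare_lt (i : Fin (numWhitehead r)) (L R J S : List (Letter r))
    (h : J.length < L.length) :
    ∃ L' R', L'.reverse ++ R' = L.reverse ++ R ∧
      Runs (aStep e) (J.length + 1) (.compare b i, tapes b T (tapeBefore L R) (tapeBefore J S))
        (.seek (!b) 0, tapes (!b) T (tapeBefore [] (J.reverse ++ S)) (tapeAt L' R')) := by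
  induction J generalizing L R S with
  | nil =>
    obtain ⟨x, L, rfl⟩ := List.exists_cons_of_length_pos h
    exact ⟨x :: L, R, rfl, Runs.single (by simp [aStep_eq, aTrans, tapes_not])⟩
  | cons y J ih =>
    obtain ⟨x, L, rfl⟩ := List.exists_cons_of_length_pos (Nat.zero_lt_of_lt h)
    obtain ⟨L', R', hword, hrun⟩ := ih L (x :: R) (y :: S) (by simpa using h)
    rw [List.reverse_cons, List.reverse_cons, List.append_assoc, List.append_assoc]
    exact ⟨L', R', hword, Runs.head (by simp [aStep_eq, aTrans]) hrun⟩

theorem runs_compare_ge (i : Fin (numWhitehead r)) (L R J S : List (Letter r))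
    (h : L.length ≤ J.length) :
    ∃ J' S', J'.reverse ++ S' = J.reverse ++ S ∧
      Runs (aStep e) (L.length + 1) (.compare b i, tapes b T (tapeBefore L R) (tapeBefore J S))
        (.seek b i.succ, tapes b T (tapeBefore [] (L.reverse ++ R)) (tapeAt J' S')) := by
  induction L generalizing R J S with
  | nil => exact ⟨J, S, rfl, Runs.single (by cases J <;> simp [aStep_eq, aTrans])⟩
  | cons x L ih =>
    obtain ⟨y, J, rfl⟩ := List.exists_cons_of_length_pos (Nat.zero_lt_of_lt h)
    obtain ⟨J', S', hword, hrun⟩ := ih (x :: R) J (y :: S) (by simpa using h)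
    rw [List.reverse_cons, List.reverse_cons, List.append_assoc, List.append_assoc]
    exact ⟨J', S', hword, Runs.head (by simp [aStep_eq, aTrans]) hrun⟩

theorem length_image_le (φ : WhiteheadDatum r) (f x : Letter r) (l : List (Letter r)) :
    (φ.image f x l).length ≤ 2 * (l.length + 1) := by
  have hkeep (x : Letter r) : (φ.keep x).toList.length ≤ 1 := by cases φ.keep x <;> simp
  have hglue (x y : Letter r) : (φ.glue x y).toList.length ≤ 1 := by cases φ.glue x y <;> simp
  induction l generalizing x with
  | nil =>
    rw [WhiteheadDatum.image, List.length_append, List.length_nil]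
    linarith [hkeep x, hglue x f]
  | cons y l ih =>
    rw [WhiteheadDatum.image, List.length_append, List.length_append, List.length_cons]
    linarith [hkeep x, hglue x y, ih y]

theorem runs_begins_to_compare (i : Fin (numWhitehead r)) (x : Letter r) (l : List (Letter r)) :
    Runs (aStep e) (2 * (l.length + 1) + 2)
      (.begins b i.castSucc, tapes b T (tapeAt [] (x :: l)) (tapeAt [] []))
      (.compare b i, tapes b T (tapeBefore (x :: l).reverse [])
        (tapeBefore ((e i).image x x l).reverse [])) := by
  have hbegins : aStep e (.begins b i.castSucc, tapes b T (tapeAt [] (x :: l)) (tapeAt [] [])) =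
      .inr (.keep b i x x, tapes b T (tapeAt [x] l) (tapeAt [] [])) := by
    simp [aStep_eq, aTrans]
  have hturn : aStep e (.turn b i, tapes b T (tapeAt (l.reverse ++ [x]) [])
      (tapeAt (((e i).image x x l).reverse ++ []) [])) =
      .inr (.compare b i, tapes b T (tapeBefore (x :: l).reverse [])
        (tapeBefore ((e i).image x x l).reverse [])) := by
    simp [aStep_eq, aTrans]
  exact (Runs.head hbegins ((runs_image e b T i x x [x] l []).trans (Runs.single hturn))).cast
    (by omega)

theorem exists_runs_of_image_lt (i : Fin (numWhitehead r)) (x : Letter r) (l : List (Letter r))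
    (h : ((e i).image x x l).length < (x :: l).length) :
    ∃ t ≤ 7 * (l.length + 2), Runs (aStep e) t
      (.begins b i.castSucc, tapes b T (tapeAt [] (x :: l)) (tapeAt [] []))
      (.begins (!b) 0, tapes (!b) T (tapeAt [] ((e i).image x x l)) (tapeAt [] [])) := by
  obtain ⟨L, R, hword, hcompare⟩ := runs_compare_lt e b T i (x :: l).reverse []
    ((e i).image x x l).reverse [] (by simpa using h)
  have hclear := runs_seek_to_begins e (!b) T 0 L R ((e i).image x x l)
  rw [List.reverse_reverse, List.append_nil] at hcompare
  refine ⟨_, ?_, ((runs_begins_to_compare e b T i x l).trans hcompare).trans hclear⟩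
  have hlength := congrArg List.length hword
  simp only [List.length_append, List.length_reverse, List.length_cons, List.length_nil]
    at hlength h ⊢
  omega

theorem exists_runs_of_le_image (i : Fin (numWhitehead r)) (x : Letter r) (l : List (Letter r))
    (h : (x :: l).length ≤ ((e i).image x x l).length) :
    ∃ t ≤ 7 * (l.length + 2), Runs (aStep e) t
      (.begins b i.castSucc, tapes b T (tapeAt [] (x :: l)) (tapeAt [] []))
      (.begins b i.succ, tapes b T (tapeAt [] (x :: l)) (tapeAt [] [])) := by
  obtain ⟨L, R, hword, hcompare⟩ := runs_compare_ge e b T i (x :: l).reverse []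
    ((e i).image x x l).reverse [] (by simpa using h)
  have hclear := runs_seek_to_begins e b T i.succ L R (x :: l)
  rw [List.reverse_reverse, List.append_nil] at hcompare
  refine ⟨_, ?_, ((runs_begins_to_compare e b T i x l).trans hcompare).trans hclear⟩
  have hlength := congrArg List.length hword
  have himage := length_image_le (e i) x x l
  simp only [List.length_append, List.length_reverse, List.length_cons, List.length_nil]
    at hlength h ⊢
  omega

end Runs

section Answer

/-- A bound for the time needed by the Whitehead algorithm on a word of length `n` if `k`
automorphisms are still to be tried. Trying one of them takes at most `7 * (n + 1)` steps. -/
def beginsTime (r n k : ℕ) : ℕ :=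
  7 * (numWhitehead r + 1) * (n * (n + 1)) + 7 * k * (n + 1) + 2

theorem beginsTime_succ (r n k : ℕ) : beginsTime r n (k + 1) = beginsTime r n k + 7 * (n + 1) := by
  unfold beginsTime
  ring

theorem beginsTime_add_le {r m n : ℕ} (h : m < n) (k : ℕ) :
    beginsTime r m (numWhitehead r) + 7 * (n + 1) ≤ beginsTime r n k := by
  obtain ⟨n, rfl⟩ := Nat.exists_eq_succ_of_ne_zero (Nat.ne_zero_of_lt h)
  calc beginsTime r m (numWhitehead r) + 7 * (n + 1 + 1)
      ≤ beginsTime r n (numWhitehead r) + 7 * (n + 1 + 1) := by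
        unfold beginsTime
        gcongr <;> omega
    _ ≤ beginsTime r (n + 1) 0 := by
        unfold beginsTime
        nlinarith [Nat.zero_le n]
    _ ≤ beginsTime r (n + 1) k := by
        unfold beginsTime
        gcongr
        exact k.zero_le

variable [NeZero r] (e : Fin (numWhitehead r) ≃ WhiteheadDatum r) (T : Tape (Option (Letter r)))

theorem answerWithin_begins_last (b : Bool) (x : Letter r) (l : List (Letter r))
    (hmin : ∀ j, (x :: l).length ≤ ((e j).image x x l).length) :
    ∃ a : Bool, answerWithin (aStep e) 2
      (.begins b (Fin.last _), tapes b T (tapeAt [] (x :: l)) (tapeAt [] [])) = some a ∧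
      (a = true ↔ IsPrimitive (FreeGroup.mk (x :: l))) := by
  have hbegins : aStep e
      (.begins b (Fin.last _), tapes b T (tapeAt [] (x :: l)) (tapeAt [] [])) =
      .inr (.final b, tapes b T (tapeAt [x] l) (tapeAt [] [])) := by
    simp [aStep_eq, aTrans]
  have hfinal : aStep e (.final b, tapes b T (tapeAt [x] l) (tapeAt [] [])) = .inl l.isEmpty := by
    cases l <;> simp [aStep_eq, aTrans]
  refine ⟨l.isEmpty, (Runs.single hbegins).answerWithin (answerWithin_one hfinal) le_rfl, ?_⟩
  rw [List.isEmpty_iff]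
  refine ⟨fun hl => hl ▸ isPrimitive_mk_singleton x, fun hprim => by_contra fun hl => ?_⟩
  obtain ⟨φ, hφ⟩ := hprim.exists_image_length_lt hl
  have hle := hmin (e.symm φ)
  rw [Equiv.apply_symm_apply] at hle
  exact hle.not_gt hφ

theorem answerWithin_begins (w : List (Letter r)) (b : Bool) (k : ℕ)
    (i : Fin (numWhitehead r + 1)) (hk : i.1 + k = numWhitehead r)
    (hi : ∀ j : Fin (numWhitehead r), j.1 < i.1 → ∀ x l, w = x :: l →
      w.length ≤ ((e j).image x x l).length) :
    ∃ a : Bool, answerWithin (aStep e) (beginsTime r w.length k)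
      (.begins b i, tapes b T (tapeAt [] w) (tapeAt [] [])) = some a ∧
      (a = true ↔ IsPrimitive (FreeGroup.mk w)) := by
  induction hn : w.length using Nat.strong_induction_on generalizing w b k i with
  | _ n ih_length =>
  subst hn
  obtain _ | ⟨x, l⟩ := w
  · have hbegins : aStep e (.begins b i, tapes b T (tapeAt [] []) (tapeAt [] [])) = .inl false := by
      simp [aStep_eq, aTrans]
    exact ⟨false, answerWithin_mono (answerWithin_one hbegins) (by unfold beginsTime; omega),
      by simpa [← FreeGroup.one_eq_mk] using not_isPrimitive_one⟩
  induction k generalizing i with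
  | zero =>
    obtain rfl : i = Fin.last _ := Fin.ext hk
    obtain ⟨a, ha, ha'⟩ := answerWithin_begins_last e T b x l fun j => hi j j.2 x l rfl
    exact ⟨a, answerWithin_mono ha (Nat.le_add_left _ _), ha'⟩
  | succ k ih_index =>
    obtain ⟨i, rfl⟩ : ∃ i' : Fin (numWhitehead r), i = i'.castSucc := ⟨⟨i.1, by omega⟩, rfl⟩
    obtain hlt | hge := lt_or_ge ((e i).image x x l).length (x :: l).length
    · obtain ⟨t, ht, hrun⟩ := exists_runs_of_image_lt e b T i x l hlt
      obtain ⟨a, ha, ha'⟩ := ih_length _ hlt _ (!b) (numWhitehead r) 0 (by simp) (by simp) rfl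
      exact ⟨a, hrun.answerWithin ha ((Nat.add_le_add_left ht _).trans (beginsTime_add_le hlt _)),
        ha'.trans (isPrimitive_mk_image_iff _ _ _)⟩
    · obtain ⟨t, ht, hrun⟩ := exists_runs_of_le_image e b T i x l hge
      obtain ⟨a, ha, ha'⟩ := ih_index i.succ (by simpa [add_right_comm, add_assoc] using hk)
        fun j hj x' l' hxl => by
          cases hxl
          obtain hj | hj := Nat.lt_succ_iff_lt_or_eq.1 hj
          · exact hi j hj x l rfl
          · exact Fin.ext hj ▸ hge
      exact ⟨a, hrun.answerWithin ha (beginsTime_succ r _ k ▸ Nat.add_le_add_left ht _), ha'⟩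

end Answer

end AlgorithmA

/-! ### The fast check in parallel with the Whitehead algorithm -/

namespace AlgorithmA

open Turing WordTape

variable {r : ℕ} (e : Fin (numWhitehead r) ≃ WhiteheadDatum r)

/-- A bound for the time needed by the Whitehead algorithm on a word of length `n` that has just
been copied to the work tape; the head of that tape first goes back to the beginning. -/
def whiteheadTime (r n : ℕ) : ℕ := beginsTime r n (numWhitehead r) + (n + 1)

/-- This is `0` if the Whitehead graph of the word is complete, and `1` otherwise. -/
def incompleteness (l : List (Letter r)) : ℕ := if HasCompleteGraph l then 0 else 1

/-- A bound for the time needed when the word `l` has been read and the word `s` remains. -/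
def readTime (l s : List (Letter r)) : ℕ :=
  1 + ∑ k ∈ Finset.range s.length, incompleteness (l ++ s.take (k + 1)) +
    incompleteness (l ++ s) * whiteheadTime r (l ++ s).length

theorem readTime_cons {l s : List (Letter r)} {y : Letter r}
    (h : ¬ HasCompleteGraph (l ++ [y])) : readTime l (y :: s) = readTime (l ++ [y]) s + 1 := by
  have hy : incompleteness (l ++ [y]) = 1 := if_neg h
  simp only [readTime, List.length_cons, Finset.sum_range_succ', List.take_succ_cons,
    List.append_assoc, List.singleton_append, List.take_zero, hy]
  ring

/-- The configuration in which the word `l` has been read and the word `s` remains. -/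
def readConfig (l s : List (Letter r)) : Config r :=
  (.read (whiteheadEdges l) l.getLast?,
    tapes false (tapeAt l.reverse s) (tapeAt l.reverse []) (tapeAt [] []))

theorem aStep_read_of_complete {l : List (Letter r)} {y : Letter r} (s : List (Letter r))
    (h : HasCompleteGraph (l ++ [y])) : aStep e (readConfig l (y :: s)) = .inl false := by
  rw [readConfig, aStep_eq]
  simp only [aTrans, tapes_zero, tapeAt_head_cons, addEdge_whiteheadEdges]
  rw [if_pos h]
  rfl

theorem aStep_read_of_not_complete {l : List (Letter r)} {y : Letter r} (s : List (Letter r))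
    (h : ¬ HasCompleteGraph (l ++ [y])) :
    aStep e (readConfig l (y :: s)) = .inr (readConfig (l ++ [y]) s) := by
  rw [readConfig, aStep_eq]
  simp only [aTrans, tapes_zero, tapeAt_head_cons, addEdge_whiteheadEdges]
  rw [if_neg h]
  simp [readConfig, appendTo]

theorem runs_read_nil (l : List (Letter r)) :
    Runs (aStep e) (l.length + 2) (readConfig l [])
      (.begins false 0,
        tapes false (tapeAt l.reverse []) (tapeAt [] l) (tapeAt [] [])) := by
  have hstep : aStep e (readConfig l []) = .inr (.rewind false 0,
      tapes false (tapeAt l.reverse []) (tapeBefore l.reverse []) (tapeAt [] [])) := by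
    simp [readConfig, aStep_eq, aTrans]
  simpa using
    Runs.head hstep (runs_rewind e false (tapeAt l.reverse []) (tapeAt [] []) 0 l.reverse [])

variable [NeZero r]

theorem answerWithin_read (l s : List (Letter r)) (hl : ¬ HasCompleteGraph l)
    (hu : FreeGroup.IsCyclicallyReduced (l ++ s)) :
    ∃ a : Bool, answerWithin (aStep e) (readTime l s) (readConfig l s) = some a ∧
      (a = true ↔ IsPrimitive (FreeGroup.mk (l ++ s))) := by
  induction s generalizing l with
  | nil =>
    obtain ⟨a, ha, ha'⟩ := answerWithin_begins e (tapeAt l.reverse []) l false (numWhitehead r) 0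
      (by simp) (by simp)
    refine ⟨a, (runs_read_nil e l).answerWithin ha (le_of_eq ?_), by rwa [List.append_nil]⟩
    simp only [readTime, incompleteness, whiteheadTime, List.append_nil, if_neg hl, List.length_nil,
      Finset.range_zero, Finset.sum_empty]
    ring
  | cons y s ih =>
    rw [List.append_cons] at hu ⊢
    by_cases hcomplete : HasCompleteGraph (l ++ [y])
    · have hnot := (hcomplete.mono List.infix_append_left).not_isPrimitive hu
      exact ⟨false, answerWithin_mono (answerWithin_one (aStep_read_of_complete e s hcomplete))
        (by unfold readTime; omega), by simpa using hnot⟩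
    · obtain ⟨a, ha, ha'⟩ := ih (l ++ [y]) hcomplete hu
      exact ⟨a, (Runs.single (aStep_read_of_not_complete e s hcomplete)).answerWithin ha
        (readTime_cons hcomplete).ge, ha'⟩

theorem answerWithin_start (u : List (Letter r)) (hu : FreeGroup.IsCyclicallyReduced u) :
    ∃ a : Bool, answerWithin (algorithmA e).step (readTime [] u)
      ((algorithmA e).start (u.map some)) = some a ∧ (a = true ↔ IsPrimitive (FreeGroup.mk u)) := by
  have hstart : (algorithmA e).start (u.map some) = readConfig [] u := by
    refine Prod.ext (congrArg (AState.read · none) whiteheadEdges_nil.symm) (funext fun j => ?_)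
    fin_cases j <;> rfl
  rw [hstart]
  exact answerWithin_read e [] u (fun h => by simpa using h.two_le_length) hu

end AlgorithmA

/-! ### The algorithm on a machine with double-ended queues -/

namespace DequeAlgorithm

open Turing

section Simulation

variable {ι Γ : Type} [Inhabited Γ]

/-- The tapes that are kept in the queues. -/
def toTapes (Q : ι × Bool → List Γ) (j : ι) : Tape Γ :=
  Tape.mk' (ListBlank.mk (Q (j, false))) (ListBlank.mk (Q (j, true)))

theorem head?_getD_default (l : List Γ) : l.head?.getD default = l.headI := by
  cases l <;> rfl

theorem toTapes_tapeOps (L R : List Γ) (p : Γ × Option Dir) :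
    Tape.mk'
        (ListBlank.mk ((tapeOps (L.head?.getD default) p false).foldl DequeOp.apply L))
        (ListBlank.mk ((tapeOps (L.head?.getD default) p true).foldl DequeOp.apply R)) =
      TuringMachine.applyAct (Tape.mk' (ListBlank.mk L) (ListBlank.mk R)) p := by
  obtain ⟨c, _ | _ | _⟩ := p
  · simp [tapeOps, TuringMachine.applyAct, DequeOp.apply, Tape.write_mk']
  · simp [tapeOps, TuringMachine.applyAct, DequeOp.apply, Tape.write_mk', Tape.move_left_mk',
      head?_getD_default]
  · simp [tapeOps, TuringMachine.applyAct, DequeOp.apply, Tape.write_mk', Tape.move_right_mk']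

end Simulation

variable {r : ℕ} (e : Fin (numWhitehead r) ≃ WhiteheadDatum r)

theorem answerWithin_some (t : ℕ) (q : AState r) (Q : Fin 3 × Bool → List (Option (Letter r))) :
    answerWithin (dequeAlgorithm e).step t (some q, Q) =
      answerWithin (algorithmA e).step t (q, toTapes Q) := by
  induction t generalizing q Q with
  | zero => rfl
  | succ t ih =>
    have hheads : (fun j => ((Q (j, true)).head?).getD none) = fun j => (toTapes Q j).head := by
      funext j
      exact head?_getD_default _
    rw [answerWithin, answerWithin]
    simp only [DequeMachine.step, dequeAlgorithm, TuringMachine.step, algorithmA, hheads]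
    cases aTrans e q fun j => (toTapes Q j).head with
    | inl a => rfl
    | inr p =>
      have htapes := funext fun j : Fin 3 =>
        toTapes_tapeOps (Q (j, false)) (Q (j, true)) (p.2 j)
      exact (ih p.1 _).trans (congrArg (fun T => answerWithin _ t (p.1, T)) htapes)

/-- The queues at the beginning. -/
def queues (u : List (Letter r)) (j : Fin 3 × Bool) : List (Option (Letter r)) :=
  if j = (0, true) then u.map some else []

theorem cancels_conj (a : Letter r) (m : List (Letter r)) :
    cancels ((queues (a :: m ++ [a.inv]) (0, true)).head?,
      (queues (a :: m ++ [a.inv]) (0, true)).getLast?) = true := by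
  simp [queues, cancels, List.getLast?_cons]

theorem cancels_eq_false {u : List (Letter r)} (hu : FreeGroup.IsCyclicallyReduced u) :
    cancels ((queues u (0, true)).head?, (queues u (0, true)).getLast?) = false := by
  cases hhead : u.head? with
  | none => simp [queues, cancels, hhead]
  | some a =>
    cases hlast : u.getLast? with
    | none => simp [queues, cancels, hlast]
    | some z =>
      have hne : a ≠ z.inv := Letter.ne_inv_iff.2 (hu.2 z hlast a hhead)
      simp only [queues, if_true, List.head?_map, List.getLast?_map, hhead, hlast, Option.map_some,
        cancels, decide_eq_false_iff_not]
      rintro rfl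
      exact hne (Letter.inv_inv a).symm

theorem step_conj (a : Letter r) (m : List (Letter r)) :
    (dequeAlgorithm e).step (none, queues (a :: m ++ [a.inv])) = .inr (none, queues m) := by
  simp only [DequeMachine.step, dequeAlgorithm, cancels_conj, if_true]
  refine congrArg Sum.inr (Prod.ext rfl (funext fun j => ?_))
  by_cases hj : j = (0, true)
  · simp [hj, queues, DequeOp.apply]
  · simp [hj, queues]

theorem step_of_isCyclicallyReduced {u : List (Letter r)} (hu : FreeGroup.IsCyclicallyReduced u) :
    (dequeAlgorithm e).step (none, queues u) = .inr (some (.read ∅ none), queues u) := by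
  simp only [DequeMachine.step, dequeAlgorithm, cancels_eq_false hu]
  rfl

theorem toTapes_queues (u : List (Letter r)) :
    (AState.read ∅ none, toTapes (queues u)) = (algorithmA e).start (u.map some) := by
  refine Prod.ext rfl (funext fun j => ?_)
  fin_cases j <;> rfl

theorem isCyclicallyReduced_or_exists_conj {u : List (Letter r)} (hu : FreeGroup.IsReduced u) :
    FreeGroup.IsCyclicallyReduced u ∨
      ∃ a m, FreeGroup.IsReduced m ∧ u = a :: m ++ [Letter.inv a] := by
  induction u using List.bidirectionalRec with
  | nil => exact .inl .nil
  | singleton x => exact .inl .singleton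
  | cons_append a m b _ =>
    obtain h | h := eq_or_ne a b.inv
    · exact .inr ⟨a, m, List.IsChain.left_of_append hu.tail,
        by rw [h, Letter.inv_inv, List.cons_append]⟩
    · exact .inl (FreeGroup.isCyclicallyReduced_cons_append_iff.2 ⟨hu, Letter.ne_inv_iff.1 h⟩)

open Classical in
/-- A bound for the time needed by the algorithm on a reduced word. -/
noncomputable def time (u : List (Letter r)) : ℕ :=
  if FreeGroup.IsCyclicallyReduced u then AlgorithmA.readTime [] u + 1
  else if u = [] then 0 else time u.tail.dropLast + 1
termination_by u.length
decreasing_by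
  have := List.length_pos_iff.2 ‹u ≠ []›
  simp only [List.length_dropLast, List.length_tail]
  omega

theorem time_of_isCyclicallyReduced {u : List (Letter r)} (hu : FreeGroup.IsCyclicallyReduced u) :
    time u = AlgorithmA.readTime [] u + 1 := by
  rw [time, if_pos hu]

theorem time_of_not_isCyclicallyReduced {u : List (Letter r)}
    (hu : ¬ FreeGroup.IsCyclicallyReduced u) : time u = time u.tail.dropLast + 1 := by
  have hne : u ≠ [] := by
    rintro rfl
    exact hu .nil
  rw [time, if_neg hu, if_neg hne]

theorem answerWithin_start [NeZero r] (u : List (Letter r)) (hu : FreeGroup.IsReduced u) :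
    ∃ a : Bool, answerWithin (dequeAlgorithm e).step (time u) (none, queues u) = some a ∧
      (a = true ↔ IsPrimitive (FreeGroup.mk u)) := by
  induction hn : u.length using Nat.strong_induction_on generalizing u with
  | _ n ih =>
  by_cases hc : FreeGroup.IsCyclicallyReduced u
  · obtain ⟨a, ha, ha'⟩ := AlgorithmA.answerWithin_start e u hc
    refine ⟨a, (Runs.single (step_of_isCyclicallyReduced e hc)).answerWithin
      ((answerWithin_some e _ _ _).trans ?_) (time_of_isCyclicallyReduced hc).ge, ha'⟩
    exact (congrArg (answerWithin (algorithmA e).step _) (toTapes_queues e u)).trans ha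
  · obtain ⟨x, m, hm, rfl⟩ := (isCyclicallyReduced_or_exists_conj hu).resolve_left hc
    obtain ⟨a, ha, ha'⟩ := ih m.length (by simp at hn; omega) m hm rfl
    refine ⟨a, (Runs.single (step_conj e x m)).answerWithin ha ?_, ha'.trans ?_⟩
    · rw [time_of_not_isCyclicallyReduced hc]
      simp
    · rw [← FreeGroup.mul_mk, mk_cons, WhiteheadDatum.mk_inv, isPrimitive_conj_iff]

end DequeAlgorithm

/-! ### Random extensions of a reduced word -/

section Extensions

variable {r : ℕ} {l : List (Letter r)}

open Classical in
/-- The words of length `n` that can follow the word `l` in a reduced word. -/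
noncomputable def extensions (l : List (Letter r)) (n : ℕ) : Finset (List (Letter r)) :=
  {s ∈ Finset.univ.image (List.ofFn (n := n)) | FreeGroup.IsReduced (l ++ s)}

/-- The reduced words of length `n`. -/
noncomputable abbrev reducedLists (r n : ℕ) : Finset (List (Letter r)) := extensions [] n

@[simp]
theorem mem_extensions {n : ℕ} {s : List (Letter r)} :
    s ∈ extensions l n ↔ s.length = n ∧ FreeGroup.IsReduced (l ++ s) := by
  simp only [extensions, Finset.mem_filter, Finset.mem_image, Finset.mem_univ, true_and]
  refine and_congr_left fun _ => ⟨?_, ?_⟩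
  · rintro ⟨w, rfl⟩
    exact List.length_ofFn
  · rintro rfl
    exact ⟨s.get, List.ofFn_get s⟩

theorem extensions_zero (hl : FreeGroup.IsReduced l) : extensions l 0 = {[]} := by
  ext s
  simp only [mem_extensions, List.length_eq_zero_iff, Finset.mem_singleton, and_iff_left_iff_imp]
  rintro rfl
  rwa [List.append_nil]

theorem sum_extensions_add {M : Type*} [AddCommMonoid M] (l : List (Letter r)) (k n : ℕ)
    (f : List (Letter r) → M) :
    ∑ s ∈ extensions l (k + n), f s =
      ∑ s ∈ extensions l k, ∑ s' ∈ extensions (l ++ s) n, f (s ++ s') := by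
  rw [Finset.sum_sigma']
  refine Finset.sum_nbij' (fun s => ⟨s.take k, s.drop k⟩) (fun p => p.1 ++ p.2) ?_ ?_ ?_ ?_ ?_
  · intro s hs
    obtain ⟨hlen, hs⟩ := mem_extensions.1 hs
    have hsplit : (l ++ s.take k) ++ s.drop k = l ++ s := by simp
    rw [Finset.mem_sigma, mem_extensions, mem_extensions, hsplit]
    refine ⟨⟨by simp [hlen], ?_⟩, by simp [hlen], hs⟩
    rw [← hsplit] at hs
    exact List.IsChain.left_of_append hs
  · rintro ⟨s, s'⟩ hs
    simp only [Finset.mem_sigma, mem_extensions] at hs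
    rw [mem_extensions, List.length_append, ← List.append_assoc, hs.1.1, hs.2.1]
    exact ⟨rfl, hs.2.2⟩
  · simp
  · rintro ⟨s, s'⟩ hs
    simp only [Finset.mem_sigma, mem_extensions] at hs
    simp [← hs.1.1]
  · simp

theorem isReduced_append_singleton_iff (hl : FreeGroup.IsReduced l) {y : Letter r} :
    FreeGroup.IsReduced (l ++ [y]) ↔ ∀ z ∈ l.getLast?, y ≠ z.inv := by
  simp only [Letter.ne_inv_iff]
  refine List.isChain_append.trans ⟨fun h z hz => h.2.2 z hz y rfl,
    fun h => ⟨hl, .singleton y, fun z hz y' hy' => ?_⟩⟩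
  obtain rfl := Option.some.inj hy'
  exact h z hz

theorem card_reducedLists_zero (r : ℕ) : (reducedLists r 0).card = 1 := by
  rw [reducedLists, extensions_zero .nil, Finset.card_singleton]

theorem card_reducedLists_one (r : ℕ) : (reducedLists r 1).card = 2 * r := by
  have h : reducedLists r 1 = Finset.univ.image fun y => [y] := by
    ext s
    simp only [mem_extensions, List.length_eq_one_iff, List.nil_append, Finset.mem_image,
      Finset.mem_univ, true_and, eq_comm (a := s), and_iff_left_iff_imp]
    rintro ⟨y, rfl⟩
    exact .singleton
  rw [h, Finset.card_image_of_injective _ List.singleton_injective, Finset.card_univ,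
    Fintype.card_prod, Fintype.card_fin, Fintype.card_bool, mul_comm]

theorem card_extensions_one (hl : FreeGroup.IsReduced l) (hne : l ≠ []) :
    (extensions l 1).card = 2 * r - 1 := by
  have hlast := List.getLast?_eq_some_getLast hne
  have h : extensions l 1 = (Finset.univ.erase (l.getLast hne).inv).image fun y => [y] := by
    ext s
    simp only [mem_extensions, List.length_eq_one_iff, Finset.mem_image, Finset.mem_erase,
      Finset.mem_univ, and_true]
    constructor
    · rintro ⟨⟨y, rfl⟩, hy⟩
      exact ⟨y, (isReduced_append_singleton_iff hl).1 hy _ hlast, rfl⟩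
    · rintro ⟨y, hy, rfl⟩
      refine ⟨⟨y, rfl⟩, (isReduced_append_singleton_iff hl).2 fun z hz => ?_⟩
      obtain rfl := Option.some.inj (hlast.symm.trans hz)
      exact hy
  rw [h, Finset.card_image_of_injective _ List.singleton_injective,
    Finset.card_erase_of_mem (Finset.mem_univ _), Finset.card_univ, Fintype.card_prod,
    Fintype.card_fin, Fintype.card_bool, mul_comm]

theorem card_extensions (hl : FreeGroup.IsReduced l) (hne : l ≠ []) (n : ℕ) :
    (extensions l n).card = (2 * r - 1) ^ n := by
  induction n with
  | zero => rw [extensions_zero hl, Finset.card_singleton, pow_zero]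
  | succ n ih =>
    have hcard : ∀ s ∈ extensions l n, (extensions (l ++ s) 1).card = 2 * r - 1 := fun s hs =>
      card_extensions_one (mem_extensions.1 hs).2 (by simp [hne])
    rw [Finset.card_eq_sum_ones, sum_extensions_add]
    simp only [← Finset.card_eq_sum_ones]
    rw [Finset.sum_congr rfl hcard, Finset.sum_const, ih, smul_eq_mul, pow_succ]

theorem card_extensions_of_mem {k : ℕ} (hk : 0 < k) {s : List (Letter r)}
    (hs : s ∈ reducedLists r k) (n : ℕ) : (extensions s n).card = (2 * r - 1) ^ n := by
  obtain ⟨hlen, hs⟩ := mem_extensions.1 hs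
  refine card_extensions hs ?_ n
  rintro rfl
  exact hk.ne hlen

theorem card_reducedLists_add {k : ℕ} (hk : 0 < k) (n : ℕ) :
    (reducedLists r (k + n)).card = (reducedLists r k).card * (2 * r - 1) ^ n := by
  rw [Finset.card_eq_sum_ones, sum_extensions_add, ← smul_eq_mul, ← Finset.sum_const]
  refine Finset.sum_congr rfl fun s hs => ?_
  rw [← Finset.card_eq_sum_ones, List.nil_append, card_extensions_of_mem hk hs]

theorem exists_isReduced_append_singleton [NeZero r] (hl : FreeGroup.IsReduced l) :
    ∃ y, FreeGroup.IsReduced (l ++ [y]) := by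
  refine ⟨l.getLast?.getD (0, true), (isReduced_append_singleton_iff hl).2 fun z hz => ?_⟩
  rw [hz, Option.getD_some]
  exact (Letter.inv_ne z).symm

theorem exists_ne_isReduced_append_singleton (hr : 2 ≤ r) (hl : FreeGroup.IsReduced l)
    (z : Letter r) : ∃ y ≠ z, FreeGroup.IsReduced (l ++ [y]) := by
  have hcard : ({z, (l.getLast?.getD z).inv} : Finset (Letter r)).card <
      (Finset.univ : Finset (Letter r)).card := by
    refine Finset.card_le_two.trans_lt ?_
    simp only [Finset.card_univ, Fintype.card_prod, Fintype.card_fin, Fintype.card_bool]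
    omega
  obtain ⟨y, -, hy⟩ := Finset.exists_mem_notMem_of_card_lt_card hcard
  rw [Finset.mem_insert, Finset.mem_singleton, not_or] at hy
  refine ⟨y, hy.1, (isReduced_append_singleton_iff hl).2 fun x hx => ?_⟩
  rw [Option.mem_def.1 hx, Option.getD_some] at hy
  exact hy.2

theorem card_reducedLists_pos [NeZero r] (n : ℕ) : 0 < (reducedLists r n).card := by
  rw [Finset.card_pos]
  induction n with
  | zero => exact ⟨[], mem_extensions.2 ⟨rfl, .nil⟩⟩
  | succ n ih =>
    obtain ⟨s, hs⟩ := ih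
    obtain ⟨hlen, hs⟩ := mem_extensions.1 hs
    obtain ⟨y, hy⟩ := exists_isReduced_append_singleton hs
    exact ⟨s ++ [y], mem_extensions.2 ⟨by simp [hlen], hy⟩⟩

/-! ### The Whitehead graph of a random word -/

/-- Inserting a suitable letter `m` makes it possible to append `x y⁻¹`; in rank one, only the
powers of the last letter can be appended. -/
theorem exists_extension_mem_whiteheadEdges [NeZero r] (hl : FreeGroup.IsReduced l)
    {x y : Letter r} (hxy : x ≠ y) : ∃ s ∈ extensions l 3, s(x, y) ∈ whiteheadEdges s := by
  obtain hr | hr : r = 1 ∨ 2 ≤ r := by have := NeZero.pos r; omega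
  · subst hr
    obtain ⟨p, hp⟩ := exists_isReduced_append_singleton hl
    refine ⟨[p, p, p], mem_extensions.2 ⟨rfl, ?_⟩, mem_whiteheadEdges.2 ⟨p, p, ⟨[], [p], rfl⟩, ?_⟩⟩
    · exact List.isChain_split.2 ⟨hp, by simp⟩
    · have hp : ∀ z : Letter 1, z = p ∨ z = p.inv := fun z =>
        Letter.eq_or_eq_inv (Subsingleton.elim _ _)
      rcases hp x, hp y with ⟨rfl | rfl, rfl | rfl⟩
      exacts [(hxy rfl).elim, rfl, Sym2.eq_swap, (hxy rfl).elim]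
  · obtain ⟨m, hmx, hm⟩ := exists_ne_isReduced_append_singleton hr hl x.inv
    refine ⟨[m, x, y.inv], mem_extensions.2 ⟨rfl, List.isChain_split.2 ⟨hm, ?_⟩⟩,
      mem_whiteheadEdges.2 ⟨x, y.inv, ⟨[m], [], rfl⟩, by rw [Letter.inv_inv]⟩⟩
    have hxm : x ≠ m.inv := fun h => hmx (by rw [h, Letter.inv_inv])
    have hyx : y.inv ≠ x.inv := fun h => hxy (by rw [← Letter.inv_inv x, ← h, Letter.inv_inv])
    exact .cons_cons (Letter.ne_inv_iff.1 hxm)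
      (.cons_cons (Letter.ne_inv_iff.1 hyx) (.singleton _))

theorem exists_extension_hasCompleteGraph (r : ℕ) [NeZero r] :
    ∃ L, 0 < L ∧ ∀ l : List (Letter r), FreeGroup.IsReduced l →
      ∃ s ∈ extensions l L, HasCompleteGraph s := by
  have hedges : ∀ P : Finset (Letter r × Letter r), (∀ p ∈ P, p.1 ≠ p.2) →
      ∃ L, ∀ l : List (Letter r), FreeGroup.IsReduced l →
        ∃ s ∈ extensions l L, ∀ p ∈ P, s(p.1, p.2) ∈ whiteheadEdges s := by
    intro P hP
    induction P using Finset.induction_on with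
    | empty => exact ⟨0, fun l hl => ⟨[], by simpa using hl, by simp⟩⟩
    | insert p P _ ih =>
      rw [Finset.forall_mem_insert] at hP
      obtain ⟨L, hL⟩ := ih hP.2
      refine ⟨L + 3, fun l hl => ?_⟩
      obtain ⟨s, hs, hsP⟩ := hL l hl
      rw [mem_extensions] at hs
      obtain ⟨s', hs', hp⟩ := exists_extension_mem_whiteheadEdges hs.2 hP.1
      rw [mem_extensions, List.append_assoc] at hs'
      refine ⟨s ++ s', by simp [hs, hs'], (Finset.forall_mem_insert _ _ _).2 ⟨?_, fun q hq => ?_⟩⟩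
      · exact whiteheadEdges_mono (List.suffix_append s s').isInfix hp
      · exact whiteheadEdges_mono (List.prefix_append s s').isInfix (hsP q hq)
  obtain ⟨L, hL⟩ := hedges Finset.univ.offDiag (by simp)
  have hcomplete : ∀ l : List (Letter r), FreeGroup.IsReduced l →
      ∃ s ∈ extensions l L, HasCompleteGraph s := fun l hl => by
    obtain ⟨s, hs, h⟩ := hL l hl
    exact ⟨s, hs, fun x y hxy => h (x, y) (by simpa using hxy)⟩
  obtain ⟨s, hs, h⟩ := hcomplete [] .nil
  have := h.two_le_length
  exact ⟨L, by rw [← (mem_extensions.1 hs).1]; omega, hcomplete⟩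

end Extensions

/-! ### Exponential decay -/

theorem exists_le_mul_pow {a : ℕ → ℝ} {c : ℝ} {L : ℕ} (ha : ∀ k, a k ≤ 1) (hc0 : 0 ≤ c)
    (hc1 : c < 1) (hL : 0 < L) (h : ∀ k, 0 < k → a (k + L) ≤ c * a k) :
    ∃ K ρ : ℝ, 0 < K ∧ 0 < ρ ∧ ρ < 1 ∧ ∀ k, a k ≤ K * ρ ^ k := by
  -- the root of some number between `c` and `1`, so that `ρ ≠ 0`
  obtain ⟨d, hcd, hd1⟩ := exists_between hc1
  have hd0 : 0 < d := hc0.trans_lt hcd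
  obtain ⟨ρ, hρ0, hρL⟩ : ∃ ρ : ℝ, 0 < ρ ∧ ρ ^ L = d :=
    ⟨d ^ (L⁻¹ : ℝ), Real.rpow_pos_of_pos hd0 _, Real.rpow_inv_natCast_pow hd0.le hL.ne'⟩
  have hρ1 : ρ < 1 := lt_of_not_ge fun hρ => (one_le_pow₀ hρ).not_gt (hρL ▸ hd1)
  refine ⟨d⁻¹, ρ, inv_pos.2 hd0, hρ0, hρ1, fun k => ?_⟩
  induction k using Nat.strong_induction_on with
  | _ k ih =>
    obtain hk | hk := le_or_gt k L
    · calc a k ≤ 1 := ha k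
        _ = d⁻¹ * ρ ^ L := by rw [hρL, inv_mul_cancel₀ hd0.ne']
        _ ≤ d⁻¹ * ρ ^ k := by gcongr ?_ * ?_; exact pow_le_pow_of_le_one hρ0.le hρ1.le hk
    · obtain ⟨j, rfl⟩ := Nat.exists_eq_add_of_le' hk.le
      calc a (j + L) ≤ c * a j := h j (by omega)
        _ ≤ c * (d⁻¹ * ρ ^ j) := by gcongr; exact ih j (by omega)
        _ ≤ d * (d⁻¹ * ρ ^ j) := by gcongr
        _ = d⁻¹ * ρ ^ (j + L) := by rw [pow_add, hρL]; ring

/-! ### The expected time of the fast check -/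

namespace AlgorithmA

variable {r : ℕ}

theorem incompleteness_le_one (l : List (Letter r)) : incompleteness l ≤ 1 := by
  unfold incompleteness
  split_ifs <;> simp

theorem sum_incompleteness_append_le {l s₀ : List (Letter r)} {n : ℕ}
    (hs₀ : s₀ ∈ extensions l n) (h : HasCompleteGraph s₀) :
    ∑ s ∈ extensions l n, incompleteness (l ++ s) ≤
      incompleteness l * ((extensions l n).card - 1) := by
  by_cases hl : HasCompleteGraph l
  · have hzero : ∀ s ∈ extensions l n, incompleteness (l ++ s) = 0 := fun s _ =>
      if_pos (hl.mono (List.prefix_append l s).isInfix)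
    rw [Finset.sum_eq_zero hzero]
    exact Nat.zero_le _
  · have hzero : incompleteness (l ++ s₀) = 0 := if_pos (h.mono (List.suffix_append l s₀).isInfix)
    have hone : incompleteness l = 1 := if_neg hl
    rw [← Finset.add_sum_erase _ _ hs₀, hzero, zero_add, hone, one_mul,
      ← Finset.card_erase_of_mem hs₀, Finset.card_eq_sum_ones]
    exact Finset.sum_le_sum fun s _ => incompleteness_le_one _

/-- The probability that the Whitehead graph of a random reduced word of length `n` is not
complete. -/
noncomputable def incompleteProb (r n : ℕ) : ℝ :=
  (∑ s ∈ reducedLists r n, incompleteness s : ℕ) / (reducedLists r n).card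

theorem incompleteProb_le_one (r n : ℕ) : incompleteProb r n ≤ 1 := by
  refine div_le_one_of_le₀ ?_ (Nat.cast_nonneg _)
  rw [Finset.card_eq_sum_ones]
  exact_mod_cast Finset.sum_le_sum fun s _ => incompleteness_le_one s

theorem incompleteProb_mul_card (r n : ℕ) [NeZero r] :
    incompleteProb r n * (reducedLists r n).card =
      (∑ s ∈ reducedLists r n, incompleteness s : ℕ) :=
  div_mul_cancel₀ _ (Nat.cast_ne_zero.2 (card_reducedLists_pos n).ne')

variable [NeZero r]

theorem incompleteProb_add_le {L : ℕ} (hL : ∀ l : List (Letter r), FreeGroup.IsReduced l →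
    ∃ s ∈ extensions l L, HasCompleteGraph s) {k : ℕ} (hk : 0 < k) :
    incompleteProb r (k + L) ≤ (1 - (((2 * r - 1 : ℕ) : ℝ) ^ L)⁻¹) * incompleteProb r k := by
  have hN : 0 < (2 * r - 1) ^ L := Nat.pow_pos (by have := NeZero.pos r; omega)
  have hcount : ∑ s ∈ reducedLists r (k + L), incompleteness s ≤
      (∑ s ∈ reducedLists r k, incompleteness s) * ((2 * r - 1) ^ L - 1) := by
    rw [sum_extensions_add, Finset.sum_mul]
    refine Finset.sum_le_sum fun s hs => ?_
    obtain ⟨s₀, hs₀, h⟩ := hL s (mem_extensions.1 hs).2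
    rw [← card_extensions_of_mem hk hs]
    exact sum_incompleteness_append_le hs₀ h
  have hR : (0 : ℝ) < (reducedLists r k).card := Nat.cast_pos.2 (card_reducedLists_pos k)
  have hN' : (0 : ℝ) < ((2 * r - 1 : ℕ) : ℝ) ^ L := by exact_mod_cast hN
  rw [incompleteProb, card_reducedLists_add hk, Nat.cast_mul, Nat.cast_pow,
    div_le_iff₀ (by positivity)]
  calc ((∑ s ∈ reducedLists r (k + L), incompleteness s : ℕ) : ℝ)
      ≤ ((∑ s ∈ reducedLists r k, incompleteness s : ℕ) : ℝ) *
          (((2 * r - 1 : ℕ) : ℝ) ^ L - 1) := by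
        have := Nat.cast_le (α := ℝ).2 hcount
        rwa [Nat.cast_mul, Nat.cast_sub hN, Nat.cast_pow, Nat.cast_one] at this
    _ = _ := by
        rw [← incompleteProb_mul_card]
        field_simp

theorem exists_incompleteProb_le (r : ℕ) [NeZero r] :
    ∃ K ρ : ℝ, 0 < K ∧ 0 < ρ ∧ ρ < 1 ∧ ∀ n, incompleteProb r n ≤ K * ρ ^ n := by
  obtain ⟨L, hL0, hL⟩ := exists_extension_hasCompleteGraph r
  have hN : (1 : ℝ) ≤ ((2 * r - 1 : ℕ) : ℝ) ^ L :=
    one_le_pow₀ (by have := NeZero.pos r; exact_mod_cast (by omega : 1 ≤ 2 * r - 1))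
  exact exists_le_mul_pow (incompleteProb_le_one r) (sub_nonneg.2 (inv_le_one_of_one_le₀ hN))
    (sub_lt_self _ (inv_pos.2 (one_pos.trans_le hN))) hL0 fun k hk => incompleteProb_add_le hL hk

theorem sum_incompleteness_take {k n : ℕ} (hk : 0 < k) (hkn : k ≤ n) :
    ((∑ s ∈ reducedLists r n, incompleteness (s.take k) : ℕ) : ℝ) =
      incompleteProb r k * (reducedLists r n).card := by
  obtain ⟨m, rfl⟩ := Nat.exists_eq_add_of_le hkn
  have hsum : ∑ s ∈ reducedLists r (k + m), incompleteness (s.take k) =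
      (∑ s ∈ reducedLists r k, incompleteness s) * (2 * r - 1) ^ m := by
    rw [sum_extensions_add, Finset.sum_mul]
    refine Finset.sum_congr rfl fun s hs => ?_
    simp only [← (mem_extensions.1 hs).1, List.take_left, List.nil_append, Finset.sum_const,
      smul_eq_mul]
    rw [card_extensions_of_mem hk hs, mul_comm]
  rw [hsum, card_reducedLists_add hk, Nat.cast_mul, Nat.cast_mul, ← mul_assoc,
    incompleteProb_mul_card]

theorem sum_readTime_eq (r n : ℕ) [NeZero r] :
    ((∑ s ∈ reducedLists r n, readTime [] s : ℕ) : ℝ) =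
      (1 + ∑ k ∈ Finset.range n, incompleteProb r (k + 1) +
        incompleteProb r n * whiteheadTime r n) * (reducedLists r n).card := by
  have hread : ∀ s ∈ reducedLists r n, readTime [] s =
      1 + ∑ k ∈ Finset.range n, incompleteness (s.take (k + 1)) +
        incompleteness s * whiteheadTime r n := fun s hs => by
    rw [readTime, List.nil_append, (mem_extensions.1 hs).1]
    simp only [List.nil_append]
  have htake : ∀ k ∈ Finset.range n, _ := fun k hk =>
    sum_incompleteness_take (r := r) k.succ_pos (Finset.mem_range.1 hk)
  rw [Finset.sum_congr rfl hread, Finset.sum_add_distrib, Finset.sum_add_distrib,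
    ← Finset.card_eq_sum_ones, Finset.sum_comm, ← Finset.sum_mul, Nat.cast_add, Nat.cast_add,
    Nat.cast_mul, ← incompleteProb_mul_card, Nat.cast_sum, Finset.sum_congr rfl htake,
    ← Finset.sum_mul]
  ring

theorem exists_whiteheadTime_mul_pow_le (r : ℕ) {ρ : ℝ} (h0 : 0 ≤ ρ) (h1 : ρ < 1) :
    ∃ D : ℝ, ∀ n, whiteheadTime r n * ρ ^ n ≤ D := by
  have hlim (j : ℕ) := tendsto_pow_const_mul_const_pow_of_lt_one j h0 h1
  have hlim' := (((hlim 2).const_mul (7 * (numWhitehead r + 1) : ℝ)).add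
    ((hlim 1).const_mul (7 * (numWhitehead r + 1) + 7 * numWhitehead r + 1 : ℝ))).add
    ((hlim 0).const_mul (7 * numWhitehead r + 3 : ℝ))
  obtain ⟨D, hD⟩ := hlim'.bddAbove_range
  refine ⟨D, fun n => (le_of_eq ?_).trans (hD ⟨n, rfl⟩)⟩
  rw [whiteheadTime, beginsTime]
  push_cast
  ring

theorem exists_sum_readTime_le (r : ℕ) [NeZero r] :
    ∃ C : ℕ, ∀ n, ∑ s ∈ reducedLists r n, readTime [] s ≤
      C * (reducedLists r n).card := by
  obtain ⟨K, ρ, hK, hρ0, hρ1, hprob⟩ := exists_incompleteProb_le r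
  obtain ⟨D, hD⟩ := exists_whiteheadTime_mul_pow_le r hρ0.le hρ1
  have hgeom (n : ℕ) : ∑ k ∈ Finset.range n, incompleteProb r (k + 1) ≤ K * (1 - ρ)⁻¹ :=
    calc ∑ k ∈ Finset.range n, incompleteProb r (k + 1)
        ≤ ∑ k ∈ Finset.range n, K * ρ ^ k := Finset.sum_le_sum fun k _ => (hprob _).trans
          (by gcongr ?_ * ?_; exact pow_le_pow_of_le_one hρ0.le hρ1.le k.le_succ)
      _ = K * ∑ k ∈ Finset.range n, ρ ^ k := by rw [Finset.mul_sum]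
      _ ≤ K * (1 - ρ)⁻¹ := by
          gcongr
          rw [← tsum_geometric_of_lt_one hρ0.le hρ1]
          exact (summable_geometric_of_lt_one hρ0.le hρ1).sum_le_tsum _
            fun _ _ => pow_nonneg hρ0.le _
  have hwhitehead (n : ℕ) : incompleteProb r n * whiteheadTime r n ≤ K * D :=
    calc incompleteProb r n * whiteheadTime r n ≤ K * ρ ^ n * whiteheadTime r n := by
          gcongr
          exact hprob n
      _ = K * (whiteheadTime r n * ρ ^ n) := by ring
      _ ≤ K * D := by gcongr; exact hD n
  refine ⟨⌈1 + K * (1 - ρ)⁻¹ + K * D⌉₊, fun n => ?_⟩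
  have hsum : ((∑ s ∈ reducedLists r n, readTime [] s : ℕ) : ℝ) ≤
      ⌈1 + K * (1 - ρ)⁻¹ + K * D⌉₊ * (reducedLists r n).card := by
    rw [sum_readTime_eq]
    gcongr
    exact (add_le_add (add_le_add_right (hgeom n) 1) (hwhitehead n)).trans (Nat.le_ceil _)
  exact_mod_cast hsum

end AlgorithmA

/-! ### Cyclically reduced words -/

section CyclicallyReduced

variable {r : ℕ}

open Classical in
/-- The cyclically reduced words of length `n`. -/
noncomputable def cyclicallyReducedLists (r n : ℕ) : Finset (List (Letter r)) :=
  {l ∈ reducedLists r n | FreeGroup.IsCyclicallyReduced l}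

theorem mem_cyclicallyReducedLists {n : ℕ} {l : List (Letter r)} :
    l ∈ cyclicallyReducedLists r n ↔ l.length = n ∧ FreeGroup.IsCyclicallyReduced l := by
  classical
  rw [cyclicallyReducedLists, Finset.mem_filter, mem_extensions, List.nil_append]
  exact ⟨fun h => ⟨h.1.1, h.2⟩, fun h => ⟨⟨h.1, h.2.isReduced⟩, h.2⟩⟩

theorem isCyclicallyReduced_of_rank_one {l : List (Letter 1)} (hl : FreeGroup.IsReduced l) :
    FreeGroup.IsCyclicallyReduced l := by
  have heq : l.IsChain Eq := hl.imp fun a b h =>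
    Prod.ext (Subsingleton.elim _ _) (h (Subsingleton.elim _ _))
  refine ⟨hl, fun a ha b hb _ => ?_⟩
  by_contra hab
  exact hab (congrArg Prod.snd (heq.pairwise.forall
    (List.mem_of_getLast? ha) (List.mem_of_head? hb) fun h => hab (congrArg Prod.snd h)))

theorem exists_isCyclicallyReduced_append_singleton (hr : 2 ≤ r) {l : List (Letter r)}
    (hl : FreeGroup.IsReduced l) : ∃ y, FreeGroup.IsCyclicallyReduced (l ++ [y]) := by
  cases l with
  | nil => exact ⟨(⟨0, by omega⟩, true), .singleton⟩
  | cons x l =>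
    obtain ⟨y, hyx, hy⟩ := exists_ne_isReduced_append_singleton hr hl x.inv
    refine ⟨y, FreeGroup.isCyclicallyReduced_cons_append_iff.2 ⟨hy, Letter.ne_inv_iff.1 ?_⟩⟩
    rintro rfl
    exact hyx (Letter.inv_inv y).symm

theorem card_reducedLists_le_card_cyclicallyReducedLists_succ (hr : 2 ≤ r) (n : ℕ) :
    (reducedLists r n).card ≤ (cyclicallyReducedLists r (n + 1)).card := by
  have hex : ∀ l ∈ reducedLists r n, ∃ y, FreeGroup.IsCyclicallyReduced (l ++ [y]) := fun l hl =>
    exists_isCyclicallyReduced_append_singleton hr (mem_extensions.1 hl).2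
  have : NeZero r := ⟨by omega⟩
  choose! y hy using hex
  refine Finset.card_le_card_of_injOn (fun l => l ++ [y l]) (fun l hl => ?_) ?_
  · exact mem_cyclicallyReducedLists.2 ⟨by simp [(mem_extensions.1 hl).1], hy l hl⟩
  · intro l _ l' _ h
    exact (List.append_inj' h rfl).1

theorem card_reducedLists_succ_le (r n : ℕ) :
    (reducedLists r (n + 1)).card ≤ 2 * r * (reducedLists r n).card := by
  obtain rfl | hn := n.eq_zero_or_pos
  · rw [card_reducedLists_one, card_reducedLists_zero, mul_one]
  · rw [card_reducedLists_add hn, pow_one, mul_comm]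
    gcongr
    omega

theorem card_reducedLists_le [NeZero r] (n : ℕ) :
    (reducedLists r n).card ≤ 2 * r * (cyclicallyReducedLists r n).card := by
  have hr := NeZero.pos r
  by_cases h : 2 ≤ r ∧ 0 < n
  · obtain ⟨n, rfl⟩ := Nat.exists_eq_succ_of_ne_zero h.2.ne'
    exact (card_reducedLists_succ_le r n).trans
      (Nat.mul_le_mul_left _ (card_reducedLists_le_card_cyclicallyReducedLists_succ h.1 n))
  · have hall : cyclicallyReducedLists r n = reducedLists r n := by
      classical
      refine Finset.filter_true_of_mem fun l hl => ?_
      obtain ⟨hlen, hl⟩ := mem_extensions.1 hl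
      obtain rfl | rfl : r = 1 ∨ n = 0 := by omega
      · exact isCyclicallyReduced_of_rank_one hl
      · rw [List.length_eq_zero_iff.1 hlen]
        exact .nil
    rw [hall]
    exact Nat.le_mul_of_pos_left _ (by omega)

theorem four_mul_mul_card_reducedLists_le (hr : 2 ≤ r) (n : ℕ) :
    4 * r * (reducedLists r n).card ≤ (reducedLists r (n + 2)).card := by
  obtain ⟨s, rfl⟩ := Nat.exists_eq_add_of_le hr
  have hs : 2 * (2 + s) - 1 = 3 + 2 * s := by omega
  obtain rfl | hn := n.eq_zero_or_pos
  · rw [card_reducedLists_zero, show 0 + 2 = 1 + 1 from rfl, card_reducedLists_add one_pos,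
      card_reducedLists_one, hs]
    nlinarith
  · rw [card_reducedLists_add hn, hs, mul_comm]
    gcongr
    nlinarith

open Classical in
theorem sum_not_isCyclicallyReduced_le (n : ℕ) (f : List (Letter r) → ℕ) :
    ∑ l ∈ reducedLists r (n + 2) with ¬ FreeGroup.IsCyclicallyReduced l, f l.tail.dropLast ≤
      2 * r * ∑ m ∈ reducedLists r n, f m := by
  let conj (p : Letter r × List (Letter r)) : List (Letter r) := p.1 :: p.2 ++ [p.1.inv]
  have hconj : Function.Injective conj := by
    rintro ⟨a, m⟩ ⟨a', m'⟩ h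
    obtain ⟨ha, hm⟩ := List.cons.inj h
    exact Prod.ext ha (List.append_inj' hm rfl).1
  calc ∑ l ∈ reducedLists r (n + 2) with ¬ FreeGroup.IsCyclicallyReduced l, f l.tail.dropLast
      ≤ ∑ l ∈ (Finset.univ ×ˢ reducedLists r n).image conj, f l.tail.dropLast := by
        refine Finset.sum_le_sum_of_subset fun l hl => ?_
        obtain ⟨hl, hcyc⟩ := Finset.mem_filter.1 hl
        obtain ⟨hlen, hl⟩ := mem_extensions.1 hl
        obtain ⟨a, m, hm, rfl⟩ :=
          (DequeAlgorithm.isCyclicallyReduced_or_exists_conj hl).resolve_left hcyc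
        exact Finset.mem_image.2 ⟨(a, m), by simpa [hm] using hlen, rfl⟩
    _ = ∑ _a : Letter r, ∑ m ∈ reducedLists r n, f m := by
        rw [Finset.sum_image hconj.injOn, Finset.sum_product]
        simp [conj]
    _ = 2 * r * ∑ m ∈ reducedLists r n, f m := by
        rw [Finset.sum_const, Finset.card_univ, smul_eq_mul, Fintype.card_prod,
          Fintype.card_fin, Fintype.card_bool, mul_comm r]

end CyclicallyReduced

/-! ### Expected runtimes -/

section Expectation

variable {r n : ℕ}

theorem map_ofFn_reducedWords :
    (reducedWords r n).map ⟨List.ofFn, List.ofFn_injective⟩ = reducedLists r n := by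
  ext l
  simp only [reducedWords, Finset.mem_map, Finset.mem_filter, Finset.mem_univ, true_and,
    Function.Embedding.coeFn_mk, mem_extensions, List.nil_append]
  constructor
  · rintro ⟨w, hw, rfl⟩
    exact ⟨List.length_ofFn, hw⟩
  · rintro ⟨rfl, hl⟩
    exact ⟨l.get, (List.ofFn_get l).symm ▸ hl, List.ofFn_get l⟩

theorem map_ofFn_cyclicallyReducedWords :
    (cyclicallyReducedWords r n).map ⟨List.ofFn, List.ofFn_injective⟩ =
      cyclicallyReducedLists r n := by
  ext l
  simp only [cyclicallyReducedWords, Finset.mem_map, Finset.mem_filter, Finset.mem_univ, true_and,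
    Function.Embedding.coeFn_mk, mem_cyclicallyReducedLists]
  constructor
  · rintro ⟨w, hw, rfl⟩
    exact ⟨List.length_ofFn, hw⟩
  · rintro ⟨rfl, hl⟩
    exact ⟨l.get, (List.ofFn_get l).symm ▸ hl, List.ofFn_get l⟩

theorem expectation_le {S : Finset (Fin n → Letter r)} {L : Finset (List (Letter r))}
    (hS : S.map ⟨List.ofFn, List.ofFn_injective⟩ = L) {X : List (Letter r) → ℕ∞}
    {f : List (Letter r) → ℕ} {C : ℕ} (hX : ∀ l ∈ L, X l ≤ f l)
    (hf : ∑ l ∈ L, f l ≤ C * L.card) : expectation S X ≤ C := by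
  subst hS
  rw [Finset.sum_map, Finset.card_map] at hf
  refine ENNReal.div_le_of_le_mul ?_
  calc ∑ w ∈ S, (X (List.ofFn w) : ℝ≥0∞) ≤ ∑ w ∈ S, (f (List.ofFn w) : ℝ≥0∞) :=
        Finset.sum_le_sum fun w hw => by
          exact_mod_cast ENat.toENNReal_le.2 (hX _ (Finset.mem_map_of_mem _ hw))
    _ ≤ C * S.card := by exact_mod_cast hf

end Expectation

theorem AlgorithmA.exists_expectation_runtime_le (r : ℕ) [NeZero r] :
    ∃ C : ℕ, ∀ (e : Fin (numWhitehead r) ≃ WhiteheadDatum r) (n : ℕ),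
      expectation (cyclicallyReducedWords r n)
        (fun u => (algorithmA e).runtime (u.map some)) ≤ C := by
  classical
  obtain ⟨C, hC⟩ := exists_sum_readTime_le r
  refine ⟨C * (2 * r), fun e n => expectation_le map_ofFn_cyclicallyReducedWords
    (f := readTime []) (fun l hl => ?_) ?_⟩
  · obtain ⟨a, ha, -⟩ := answerWithin_start e l (mem_cyclicallyReducedLists.1 hl).2
    exact stepCount_le ha
  · calc ∑ l ∈ cyclicallyReducedLists r n, readTime [] l
        ≤ ∑ l ∈ reducedLists r n, readTime [] l :=
          Finset.sum_le_sum_of_subset (Finset.filter_subset _ _)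
      _ ≤ C * (reducedLists r n).card := hC n
      _ ≤ C * (2 * r * (cyclicallyReducedLists r n).card) := by
          gcongr
          exact card_reducedLists_le n
      _ = C * (2 * r) * (cyclicallyReducedLists r n).card := by ring

namespace DequeAlgorithm

variable {r : ℕ} [NeZero r]

open Classical in
theorem two_mul_sum_time_not_isCyclicallyReduced_le {K n : ℕ}
    (hK : ∀ m < n, ∑ l ∈ reducedLists r m, time l ≤ K * (reducedLists r m).card) :
    2 * ∑ l ∈ reducedLists r n with ¬ FreeGroup.IsCyclicallyReduced l, time l.tail.dropLast ≤
      K * (reducedLists r n).card := by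
  obtain h | ⟨l, hl⟩ := Finset.eq_empty_or_nonempty
    {l ∈ reducedLists r n | ¬ FreeGroup.IsCyclicallyReduced l}
  · simp [h]
  obtain ⟨hl, hcyc⟩ := Finset.mem_filter.1 hl
  obtain ⟨hlen, hl⟩ := mem_extensions.1 hl
  have hr : 2 ≤ r := by
    by_contra hr
    obtain rfl : r = 1 := by have := NeZero.pos r; omega
    exact hcyc (isCyclicallyReduced_of_rank_one hl)
  obtain ⟨a, m, -, rfl⟩ := (isCyclicallyReduced_or_exists_conj hl).resolve_left hcyc
  obtain ⟨n, rfl⟩ : ∃ n', n = n' + 2 := ⟨m.length, by simp [← hlen]⟩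
  calc _ ≤ 2 * (2 * r * ∑ m ∈ reducedLists r n, time m) := by
        gcongr
        exact sum_not_isCyclicallyReduced_le n time
    _ ≤ 2 * (2 * r * (K * (reducedLists r n).card)) := by
        gcongr
        exact hK n (by omega)
    _ = K * (4 * r * (reducedLists r n).card) := by ring
    _ ≤ K * (reducedLists r (n + 2)).card := by
        gcongr
        exact four_mul_mul_card_reducedLists_le hr n

theorem sum_time_le {C : ℕ} (hC : ∀ n, ∑ l ∈ reducedLists r n, AlgorithmA.readTime [] l ≤
    C * (reducedLists r n).card) (n : ℕ) :
    ∑ l ∈ reducedLists r n, time l ≤ 2 * (C + 1) * (reducedLists r n).card := by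
  classical
  induction n using Nat.strong_induction_on with
  | _ n ih =>
  have htime : ∀ l : List (Letter r), time l ≤ 1 + (AlgorithmA.readTime [] l +
      if FreeGroup.IsCyclicallyReduced l then 0 else time l.tail.dropLast) := fun l => by
    split_ifs with hl
    · rw [time_of_isCyclicallyReduced hl]
      omega
    · rw [time_of_not_isCyclicallyReduced hl]
      omega
  have hrec := two_mul_sum_time_not_isCyclicallyReduced_le ih
  calc ∑ l ∈ reducedLists r n, time l
      ≤ (reducedLists r n).card + (∑ l ∈ reducedLists r n, AlgorithmA.readTime [] l +
        ∑ l ∈ reducedLists r n with ¬ FreeGroup.IsCyclicallyReduced l, time l.tail.dropLast) := by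
        rw [Finset.card_eq_sum_ones, Finset.sum_filter, ← Finset.sum_add_distrib,
          ← Finset.sum_add_distrib]
        simpa only [ite_not] using Finset.sum_le_sum fun l _ => htime l
    _ ≤ 2 * (C + 1) * (reducedLists r n).card := by linarith [hC n]

theorem exists_expectation_runtime_le (r : ℕ) [NeZero r] :
    ∃ C : ℕ, ∀ (e : Fin (numWhitehead r) ≃ WhiteheadDatum r) (n : ℕ),
      expectation (reducedWords r n) (fun u => (dequeAlgorithm e).runtime (u.map some)) ≤ C := by
  obtain ⟨C, hC⟩ := AlgorithmA.exists_sum_readTime_le r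
  refine ⟨2 * (C + 1), fun e n => expectation_le map_ofFn_reducedWords (f := time)
    (fun l hl => ?_) (sum_time_le hC n)⟩
  obtain ⟨a, ha, -⟩ := answerWithin_start e l (mem_extensions.1 hl).2
  exact stepCount_le ha

end DequeAlgorithm

theorem theorem1 (r : ℕ) [NeZero r] :
    ∃ C : ℝ≥0, ∀ e : Fin (numWhitehead r) ≃ WhiteheadDatum r,
      ((∀ u : List (Letter r), FreeGroup.IsCyclicallyReduced u →
          ∃ b : Bool, (algorithmA e).Answers (u.map some) b ∧
            (b = true ↔ IsPrimitive (FreeGroup.mk u))) ∧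
        ∀ n : ℕ, expectation (cyclicallyReducedWords r n)
          (fun u => (algorithmA e).runtime (u.map some)) ≤ C) ∧
      ((∀ u : List (Letter r), FreeGroup.IsReduced u →
          ∃ b : Bool, (dequeAlgorithm e).Answers (u.map some) b ∧
            (b = true ↔ IsPrimitive (FreeGroup.mk u))) ∧
        ∀ n : ℕ, expectation (reducedWords r n)
          (fun u => (dequeAlgorithm e).runtime (u.map some)) ≤ C) := by
  obtain ⟨C₁, hC₁⟩ := AlgorithmA.exists_expectation_runtime_le r
  obtain ⟨C₂, hC₂⟩ := DequeAlgorithm.exists_expectation_runtime_le r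
  refine ⟨(max C₁ C₂ : ℕ), fun e => ⟨⟨fun u hu => ?_, fun n => ?_⟩, fun u hu => ?_, fun n => ?_⟩⟩
  · obtain ⟨b, hb, hprim⟩ := AlgorithmA.answerWithin_start e u hu
    exact ⟨b, ⟨_, hb⟩, hprim⟩
  · exact (hC₁ e n).trans (by exact_mod_cast le_max_left C₁ C₂)
  · obtain ⟨b, hb, hprim⟩ := DequeAlgorithm.answerWithin_start e u hu
    exact ⟨b, ⟨_, hb⟩, hprim⟩
  · exact (hC₂ e n).trans (by exact_mod_cast le_max_right C₁ C₂)
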